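/- Let $I=\{w,x,y,z\}$ and let $\mathcal M_{ZY}$ be the family of all subsets of $\{w,y,z\}$, $\{x,y,z\}$ and $\{w,x\}$. A marginal model on $\mathcal M_{ZY}$ is a family $(P_S)_{S\in\mathcal M_{ZY}}$ of probability distributions of tuples $A_S=(A_i)_{i\in S}$ such that $P_T$ is the marginal of $P_S$ whenever $T\subseteq S$; it is contextual if there is no joint distribution of $(A_w,A_x,A_y,A_z)$ having all the $P_S$ as marginals. Let $f^{ZY}:\mathcal M_{ZY}\to\mathbb R$ be $0$ on $\emptyset$, $2$ on singletons, $4$ on $\{w,x\}$, $3$ on the other five pairs, and $4$ on $\{w,y,z\}$ and $\{x,y,z\}$. Write $f_{ab\cdots}$ for $f(\{a,b,\dots\})$ and consider the Zhang–Yeung inequality $$-4f_{wyz}-f_{xyz}-f_{wx}+3f_{wy}+3f_{wz}+f_{xy}+f_{xz}+3f_{yz}-f_w-2f_y-2f_z\ \ge\ 0 .\qquad(\mathrm{ZY})$$ All entropies are in bits. A polymatroid on $I$ is a function $f:2^I\to\mathbb R$ with $f(\emptyset)=0$, $f\ge 0$, $f(S)\le f(T)$ for $S\subseteq T$, and $f(S\cap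 T)+f(S\cup T)\le f(S)+f(T)$; a partial polymatroid on $\mathcal M_{ZY}$ is a function on $\mathcal M_{ZY}$ satisfying these conditions for all $S,T\in\mathcal M_{ZY}$ with $S\cup T\in\mathcal M_{ZY}$. A linear inequality $\sum_S c_S f(S)\ge 0$ is of Shannon type if it is a non-negative linear combination of the inequalities (and of $f(\emptyset)=0$) that define polymatroids, and of Shannon type for differential entropy if it is a non-negative linear combination of the submodularity inequalities $f(S)+f(T)-f(S\cap T)-f(S\cup T)\ge0$ and of $\pm f(\emptyset)\ge 0$. (1) Let $\alpha_w,\alpha_x,\alpha_y,\alpha_z,\beta,\beta'$ be independent uniform bits. For $S\in\mathcal M_{ZY}$ let $P_S$ be the distribution of $(A_i)_{i\in S}$ with $A_i=(\alpha_i,\beta)$, except that $A_x=(\alpha_x,\beta')$ for $S=\{w,x\}$. This is a marginal model, its Shannon entropies are $H(A_S)=f^{ZY}(S)$ for all $S\in\mathcal M_{ZY}$, and $f^{ZY}$ is a partial polymatroid. The inequality (ZY) involves only sets in $\mathcal M_{ZY}$, holds for the Shannon entropies of all quadruples of discrete (countably valued) random variables with finite entropies, and is not of Shannon type. It is violated by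 the entropies of this marginal model, which is contextual. However, $f^{ZY}$ extends to a polymatroid on $I$, and the entropies of the model satisfy every Shannon-type inequality that involves only sets in $\mathcal M_{ZY}$. (2) The inequality (ZY) also holds for the differential entropies of all quadruples of jointly distributed random vectors (of arbitrary finite dimensions) for which every marginal $A_S$, $S\subseteq I$, has a density and a finite differential entropy, and it is not of Shannon type for differential entropy. There is a marginal model on $\mathcal M_{ZY}$ with real-valued variables, all of whose distributions $P_S$ have densities and finite differential entropies $h(A_S)=f^{ZY}(S)$, which violates (ZY) and is contextual. However, the function $S\mapsto h(A_S)$ on $\mathcal M_{ZY}$ extends to a function $g:2^I\to\mathbb R$ with $g(\emptyset)=0$ and $g(S\cap T)+g(S\cup T)\le g(S)+g(T)$ for all $S,T\subseteq I$, and it satisfies every inequality of Shannon type for differential entropy that involves only sets in $\mathcal M_{ZY}$. -/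

import Mathlib

open MeasureTheory

namespace EntropicMarginal

/-! ### Marginal scenarios and marginal models -/

/-- A marginal scenario: a non-empty family of subsets of `I`, closed under passing to subsets. -/
structure MarginalScenario (I : Type*) [DecidableEq I] where
  faces : Finset (Finset I)
  nonempty : faces.Nonempty
  down_closed : ∀ ⦃S T : Finset I⦄, S ∈ faces → T ⊆ S → T ∈ faces

/-- The marginal scenario generated by a non-empty family of sets: all subsets of its members. -/
def MarginalScenario.generate {I : Type*} [DecidableEq I] (X : Finset (Finset I))
    (hX : X.Nonempty) : MarginalScenario I where
  faces := X.biUnion Finset.powerset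
  nonempty := by
    obtain ⟨S, hS⟩ := hX
    exact ⟨S, Finset.mem_biUnion.2 ⟨S, hS, Finset.mem_powerset_self S⟩⟩
  down_closed := by
    intro S T hS hTS
    obtain ⟨U, hU, hSU⟩ := Finset.mem_biUnion.1 hS
    exact Finset.mem_biUnion.2
      ⟨U, hU, Finset.mem_powerset.2 (hTS.trans (Finset.mem_powerset.1 hSU))⟩

/-- A marginal model: a compatible family of probability distributions `dist S` of the tuples
`(A_i)_{i ∈ S}`, one for each `S` in the scenario; `A_i` takes values in `α i`. -/
structure MarginalModel {I : Type*} [DecidableEq I] (M : MarginalScenario I)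
    (α : I → Type*) [∀ i, MeasurableSpace (α i)] where
  dist : ∀ S : M.faces, Measure ((i : S.1) → α i)
  isProbabilityMeasure : ∀ S, IsProbabilityMeasure (dist S)
  compatible : ∀ (S T : M.faces) (h : T.1 ⊆ S.1),
    (dist S).map (Finset.restrict₂ h) = dist T

/-- A marginal model is contextual if there is no joint distribution of all the variables that has
the given distributions as its marginals. -/
def MarginalModel.IsContextual {I : Type*} [DecidableEq I] {M : MarginalScenario I}
    {α : I → Type*} [∀ i, MeasurableSpace (α i)] (Q : MarginalModel M α) : Prop :=
  ¬ ∃ P : Measure ((i : I) → α i), IsProbabilityMeasure P ∧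
      ∀ S : M.faces, P.map S.1.restrict = Q.dist S

/-! ### Entropies, in bits -/

/-- Shannon entropy of a distribution on a countable discrete space. -/
noncomputable def shannonEntropy {Ω : Type*} [MeasurableSpace Ω] (μ : Measure Ω) : ℝ :=
  - ∑' a, μ.real {a} * Real.logb 2 (μ.real {a})

/-- The series defining the Shannon entropy converges (all its terms have the same sign). -/
def HasFiniteShannonEntropy {Ω : Type*} [MeasurableSpace Ω] (μ : Measure Ω) : Prop :=
  Summable fun a => μ.real {a} * Real.logb 2 (μ.real {a})

/-- Differential entropy with respect to Lebesgue measure. -/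
noncomputable def diffEntropy {Ω : Type*} [MeasureSpace Ω] (μ : Measure Ω) : ℝ :=
  - ∫ a, (μ.rnDeriv volume a).toReal * Real.logb 2 (μ.rnDeriv volume a).toReal

/-- `μ` has a density with respect to Lebesgue measure and its differential entropy exists and is
finite. -/
def HasFiniteDiffEntropy {Ω : Type*} [MeasureSpace Ω] (μ : Measure Ω) : Prop :=
  μ ≪ volume ∧
    Integrable fun a => (μ.rnDeriv volume a).toReal * Real.logb 2 (μ.rnDeriv volume a).toReal

/-! ### Polymatroids and submodular functions -/

/-- (The rank function of) a polymatroid on `I`. -/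
structure IsPolymatroid {I : Type*} [DecidableEq I] (f : Finset I → ℝ) : Prop where
  empty : f ∅ = 0
  nonneg : ∀ S, 0 ≤ f S
  mono : ∀ S T, S ⊆ T → f S ≤ f T
  submod : ∀ S T, f (S ∩ T) + f (S ∪ T) ≤ f S + f T

/-- A submodular function on all subsets of `I`. -/
structure IsSubmodular {I : Type*} [DecidableEq I] (f : Finset I → ℝ) : Prop where
  empty : f ∅ = 0
  submod : ∀ S T, f (S ∩ T) + f (S ∪ T) ≤ f S + f T

/-- A partial polymatroid on a marginal scenario: the polymatroid axioms are imposed on those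
`S`, `T` in the scenario whose union lies in the scenario. -/
structure IsPartialPolymatroid {I : Type*} [DecidableEq I] {M : MarginalScenario I}
    (f : M.faces → ℝ) : Prop where
  empty : ∀ h : ∅ ∈ M.faces, f ⟨∅, h⟩ = 0
  nonneg : ∀ S, 0 ≤ f S
  mono : ∀ S T : M.faces, S.1 ⊆ T.1 → f S ≤ f T
  submod : ∀ (S T : M.faces) (h : S.1 ∪ T.1 ∈ M.faces),
    f ⟨S.1 ∩ T.1, M.down_closed S.2 Finset.inter_subset_left⟩ + f ⟨S.1 ∪ T.1, h⟩ ≤ f S + f T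

/-! ### Linear inequalities

A vector of coefficients `c : Finset I → ℝ` stands for the inequality `∑ S, c S * f S ≥ 0`. -/

/-- The coefficient vector of the single term `f S`. -/
def term {I : Type*} [DecidableEq I] (S : Finset I) : Finset I → ℝ := Pi.single S 1

/-- The submodularity inequalities `f S + f T - f (S ∩ T) - f (S ∪ T) ≥ 0`. -/
def submodularityInequalities (I : Type*) [DecidableEq I] : Set (Finset I → ℝ) :=
  {c | ∃ S T : Finset I, c = term S + term T - term (S ∩ T) - term (S ∪ T)}

/-- The equation `f ∅ = 0`, as a pair of inequalities. -/
def normalizationInequalities (I : Type*) [DecidableEq I] : Set (Finset I → ℝ) :=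
  {term ∅, - term ∅}

/-- The basic inequalities that define polymatroids. -/
def basicInequalities (I : Type*) [DecidableEq I] : Set (Finset I → ℝ) :=
  normalizationInequalities I ∪ {c | ∃ S : Finset I, c = term S} ∪
    {c | ∃ S T : Finset I, S ⊆ T ∧ c = term T - term S} ∪ submodularityInequalities I

/-- Shannon-type inequalities: non-negative linear combinations of the basic inequalities. -/
def IsShannonType {I : Type*} [DecidableEq I] (c : Finset I → ℝ) : Prop :=
  c ∈ PointedCone.hull ℝ (basicInequalities I)

/-- Shannon-type inequalities for differential entropy: non-negative linear combinations of the
submodularity inequalities (and of `f ∅ = 0`). -/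
def IsDiffShannonType {I : Type*} [DecidableEq I] (c : Finset I → ℝ) : Prop :=
  c ∈ PointedCone.hull ℝ (normalizationInequalities I ∪ submodularityInequalities I)

/-- The inequality involves only terms `f S` with `S` in the marginal scenario. -/
def SupportedOn {I : Type*} [DecidableEq I] (M : MarginalScenario I) (c : Finset I → ℝ) : Prop :=
  ∀ S, S ∉ M.faces → c S = 0

/-- The left-hand side `∑ S, c S * f S` for a function `f` on the marginal scenario. -/
def evalOn {I : Type*} [DecidableEq I] {M : MarginalScenario I} (c : Finset I → ℝ)
    (f : M.faces → ℝ) : ℝ :=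
  ∑ S : M.faces, c S.1 * f S

/-- The inequality holds for the Shannon entropies of all jointly distributed discrete random
variables with finite entropies. -/
def IsEntropicInequality {I : Type} [Fintype I] [DecidableEq I] (c : Finset I → ℝ) : Prop :=
  ∀ (α : I → Type) [∀ i, MeasurableSpace (α i)] [∀ i, Countable (α i)]
    [∀ i, MeasurableSingletonClass (α i)] (P : Measure ((i : I) → α i)) [IsProbabilityMeasure P],
    (∀ S : Finset I, HasFiniteShannonEntropy (P.map S.restrict)) →
      0 ≤ ∑ S : Finset I, c S * shannonEntropy (P.map S.restrict)

/-- The inequality holds for the differential entropies of all jointly distributed continuous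
random variables `A_i`, with values in `ℝ ^ (d i)`, with finite differential entropies. -/
def IsDiffEntropicInequality {I : Type} [Fintype I] [DecidableEq I] (c : Finset I → ℝ) : Prop :=
  ∀ (d : I → ℕ) (P : Measure ((i : I) → Fin (d i) → ℝ)) [IsProbabilityMeasure P],
    (∀ S : Finset I, HasFiniteDiffEntropy (P.map S.restrict)) →
      0 ≤ ∑ S : Finset I, c S * diffEntropy (P.map S.restrict)

/-! ### The Zhang–Yeung scenario -/

/-- The indices of the four random variables. -/
inductive Var : Type
  | w | x | y | z
  deriving DecidableEq

open Var

instance : Fintype Var := ⟨{w, x, y, z}, by intro i; cases i <;> decide⟩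

/-- The marginal scenario generated by `{w, y, z}`, `{x, y, z}` and `{w, x}`. -/
def zyScenario : MarginalScenario Var :=
  MarginalScenario.generate {{w, y, z}, {x, y, z}, {w, x}} (Finset.insert_nonempty _ _)

/-- The Zhang–Yeung inequality. -/
noncomputable def zyInequality : Finset Var → ℝ :=
  - (4 : ℝ) • term {w, y, z} - term {x, y, z} - term {w, x}
    + (3 : ℝ) • term {w, y} + (3 : ℝ) • term {w, z}
    + term {x, y} + term {x, z} + (3 : ℝ) • term {y, z}
    - term {w} - (2 : ℝ) • term {y} - (2 : ℝ) • term {z}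

/-- The partial polymatroid `f^ZY`: it is `0` on `∅`, `2` on singletons, `4` on `{w, x}`, `3` on
the other pairs and `4` on triples. -/
def fZY (S : zyScenario.faces) : ℝ :=
  if S.1 = ∅ then 0
  else if S.1 = {w, x} then 4
  else if S.1.card = 1 then 2
  else if S.1.card = 2 then 3
  else 4

/-- The independent uniform bits `(α_w, α_x, α_y, α_z)` and `β`, `β'`. -/
abbrev Bits : Type := (Var → Bool) × Bool × Bool

/-- The variables `(A_i)_{i ∈ S}` as functions of the bits: `A_i = (α_i, β)` consists of a private
bit and a shared bit, except that in the context `{w, x}` the variable `A_x = (α_x, β')` has a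
second bit of its own. -/
def readOut (S : Finset Var) (ω : Bits) : (i : S) → Bool × Bool :=
  fun i => (ω.1 i, if i.1 = x ∧ w ∈ S then ω.2.2 else ω.2.1)

/-- The distribution of `(A_i)_{i ∈ S}`. -/
noncomputable def bitDist (S : Finset Var) : Measure ((i : S) → Bool × Bool) :=
  ((PMF.uniformOfFintype Bits).map (readOut S)).toMeasure

theorem map_uniform_equiv {Ω : Type*} [Fintype Ω] [Nonempty Ω] (e : Ω ≃ Ω) :
    (PMF.uniformOfFintype Ω).map e = PMF.uniformOfFintype Ω := by
  classical
  ext a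
  rw [PMF.map_apply, tsum_eq_single (e.symm a)]
  · simp
  · intro b hb
    rw [if_neg]
    rintro rfl
    simp at hb

theorem bitDist_compatible (S T : zyScenario.faces) (h : T.1 ⊆ S.1) :
    (bitDist S.1).map (Finset.restrict₂ (π := fun _ => Bool × Bool) h) = bitDist T.1 := by
  obtain ⟨S, hS⟩ := S
  obtain ⟨T, hT⟩ := T
  simp only at h ⊢
  unfold bitDist
  rw [PMF.toMeasure_map _ _ (measurable_of_finite _), PMF.map_comp]
  congr 1
  by_cases hc : x ∈ T ∧ w ∈ S ∧ w ∉ T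
  · obtain ⟨hx, hw, hwT⟩ := hc
    have hTx : T = {x} := by
      revert S T
      decide
    subst hTx
    conv_rhs => rw [← map_uniform_equiv (Equiv.prodCongr (Equiv.refl (Var → Bool))
      (Equiv.prodComm Bool Bool)), PMF.map_comp]
    congr 1
    funext ω i
    have hi : i.1 = x := Finset.mem_singleton.1 i.2
    simp [readOut, Finset.restrict₂, hi, hw]
  · congr 1
    funext ω i
    have hiT := i.2
    by_cases hi : i.1 = x
    · rw [hi] at hiT
      have : w ∈ S ↔ w ∈ T := ⟨fun hw => by by_contra hn; exact hc ⟨hiT, hw, hn⟩, fun hw => h hw⟩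
      simp [readOut, Finset.restrict₂, this]
    · simp [readOut, Finset.restrict₂, hi]

/-- The marginal model built from the bits. -/
noncomputable def zyModel : MarginalModel zyScenario (fun _ => Bool × Bool) where
  dist S := bitDist S.1
  isProbabilityMeasure S := by
    unfold bitDist
    infer_instance
  compatible := bitDist_compatible

end EntropicMarginal

/-!
The Zhang–Yeung inequality is proved at once for discrete and for continuous variables: in both
cases the tuple `(A_w, A_x, A_y, A_z)` has a density `p` with respect to a product of σ-finite
measures (counting measure or Lebesgue measure), and the entropy of a marginal is the expectation of
minus the logarithm of the marginal density, which is `lmarginal` of `p`.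

Let `r` be a copy of `A_w` that, given `(A_y, A_z)`, is independent of `(A_w, A_x)`; the five
variables have the density `copyDensity`.  The triples `(A_w, A_y, A_z)` and `(r, A_y, A_z)` have the
same law, and the inequality is the sum of eight instances of the non-negativity of conditional
mutual information for the five variables.  Each of them says that a ratio of densities has
expectation at most `1` (`lintegral_mul_ratio_le`).  Nothing is assumed on the entropies of the
marginals in which `r` and `A_w` or `A_x` both occur, so the eight inequalities are not integrated
separately: their logarithms are added pointwise, where these marginals cancel, and `log t ≤ t - 1`
is applied to the sum (`integral_nonpos_of_le_sum_log`, `zhangYeung_density`).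

Everything else rests on the function `rankZY`, a polymatroid on all sets of variables that extends
`fZY` and violates the inequality.  It shows that the inequality is not of Shannon type and that
Shannon-type inequalities hold for `fZY`.  Since all fibres of `readOut S` have the same size, the
entropies of the discrete model are the integers `fZY S`; so the discrete model is contextual by the
Zhang–Yeung inequality.  The continuous model consists of the pairs of bits, encoded as
`0, 1, 2, 3`, plus independent uniform noise on `[0, 1)`.  The noise has entropy `0`, and the bits
can be recovered from the sum; thus the entropies are the same, and a joint distribution of the
continuous model, whether it has a density or not, would yield one of the discrete model.
-/

namespace EntropicMarginal
open Finset Function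
open scoped ENNReal

/-! ### Marginals of densities with respect to product measures -/

section Lmarginal

variable {δ : Type*} [DecidableEq δ] {X : δ → Type*} [∀ i, MeasurableSpace (X i)]
  {μ : ∀ i, Measure (X i)}

theorem dependsOn_lmarginal {f : (∀ i, X i) → ℝ≥0∞} {A : Finset δ} (hf : DependsOn f (A : Set δ))
    (s : Finset δ) : DependsOn (lmarginal μ s f) ((A \ s : Finset δ) : Set δ) := by
  intro a b hab
  unfold MeasureTheory.lmarginal
  refine lintegral_congr fun y => hf fun i hi => ?_
  by_cases his : i ∈ s
  · simp [updateFinset, his]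
  · simpa [updateFinset, his] using hab i (by simpa [his] using hi)

theorem lmarginal_mul_of_dependsOn {f g : (∀ i, X i) → ℝ≥0∞} {A s : Finset δ}
    (hf : Measurable f) (hg : DependsOn g (A : Set δ)) (hA : Disjoint A s) :
    lmarginal μ s (f * g) = lmarginal μ s f * g := by
  funext ω
  have h : ∀ y, g (updateFinset ω s y) = g ω := fun y => hg fun i hi => by
    have : i ∉ s := Finset.disjoint_left.1 hA hi
    simp [updateFinset, this]
  simp only [MeasureTheory.lmarginal, Pi.mul_apply, h]
  exact lintegral_mul_const _ (hf.comp measurable_updateFinset)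

variable [∀ i, SigmaFinite (μ i)]

theorem lmarginal_lmarginal {f : (∀ i, X i) → ℝ≥0∞} (hf : Measurable f) (s t u : Finset δ)
    (hst : Disjoint s t) (hu : s ∪ t = u) : lmarginal μ s (lmarginal μ t f) = lmarginal μ u f := by
  rw [← hu, lmarginal_union μ f hf hst]

variable [Fintype δ]

theorem lmarginal_compl_lmarginal {f : (∀ i, X i) → ℝ≥0∞} (hf : Measurable f) (s : Finset δ)
    (ω : ∀ i, X i) : lmarginal μ sᶜ (lmarginal μ s f) ω = ∫⁻ a, f a ∂Measure.pi μ := by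
  rw [lmarginal_lmarginal hf sᶜ s univ disjoint_compl_left
    (Finset.union_comm sᶜ s ▸ Finset.union_compl s), lmarginal_univ]

theorem lintegral_eq_zero_of_lmarginal {f : (∀ i, X i) → ℝ≥0∞} (hf : Measurable f) (s : Finset δ)
    (h : ∀ ω, lmarginal μ s f ω = 0) : ∫⁻ a, f a ∂Measure.pi μ = 0 := by
  rcases isEmpty_or_nonempty (∀ i, X i) with _ | ⟨⟨ω⟩⟩
  · simp [lintegral_of_isEmpty]
  · have : lmarginal μ s f = lmarginal μ s 0 := by
      funext ω
      rw [h]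
      simp [MeasureTheory.lmarginal]
    rw [lintegral_eq_of_lmarginal_eq s hf measurable_zero this]
    simp

/-- The marginals of an integrable density are almost everywhere finite. -/
theorem ae_lmarginal_ne_top {f : (∀ i, X i) → ℝ≥0∞} (hf : Measurable f)
    (hfi : ∫⁻ a, f a ∂Measure.pi μ ≠ ∞) (s : Finset δ) :
    ∀ᵐ ω ∂Measure.pi μ, lmarginal μ s f ω ≠ ∞ := by
  set m := lmarginal μ s f with hm
  have hmm : Measurable m := hf.lmarginal μ
  set g : (∀ i, X i) → ℝ≥0∞ := {ω | m ω = ∞}.indicator (fun _ => ∞) with hg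
  have hset : MeasurableSet {ω | m ω = ∞} := hmm (measurableSet_singleton _)
  have hgm : Measurable g := measurable_const.indicator hset
  have hgz : ∀ ω, lmarginal μ sᶜ g ω = 0 := by
    intro ω
    have hle : lmarginal μ sᶜ g ω ≤ ∫⁻ a, f a ∂Measure.pi μ := by
      rw [← lmarginal_compl_lmarginal hf s ω]
      refine lmarginal_mono (fun ω => ?_) ω
      by_cases h : m ω = ∞
      · rw [← hm, h]; exact le_top
      · simp [hg, h]
    have hne : lmarginal μ sᶜ g ω ≠ ∞ := ne_top_of_le_ne_top hfi hle
    -- `g` takes the values `0` and `∞` only, so that `2 * g = g`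
    have h2 : 2 * lmarginal μ sᶜ g ω = lmarginal μ sᶜ g ω := by
      unfold MeasureTheory.lmarginal
      have hgm' : Measurable fun y : (i : (sᶜ : Finset δ)) → X i => g (updateFinset ω sᶜ y) :=
        hgm.comp measurable_updateFinset
      rw [← lintegral_const_mul _ hgm']
      refine lintegral_congr fun y => ?_
      by_cases h : m (updateFinset ω sᶜ y) = ∞ <;> simp [hg, h]
    rw [two_mul] at h2
    have := ENNReal.add_right_inj hne (b := lmarginal μ sᶜ g ω) (c := 0)
    exact this.1 (by rw [h2, add_zero])
  have h0 := lintegral_eq_zero_of_lmarginal hgm sᶜ hgz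
  rw [lintegral_eq_zero_iff hgm] at h0
  filter_upwards [h0] with ω hω h
  simp [hg, h] at hω

/-- The marginals of an integrable density are almost surely positive and finite. -/
theorem ae_withDensity_lmarginal {f : (∀ i, X i) → ℝ≥0∞} (hf : Measurable f)
    (hfi : ∫⁻ a, f a ∂Measure.pi μ ≠ ∞) (s : Finset δ) :
    ∀ᵐ ω ∂(Measure.pi μ).withDensity f, lmarginal μ s f ω ≠ 0 ∧ lmarginal μ s f ω ≠ ∞ := by
  set m := lmarginal μ s f with hm
  have hmm : Measurable m := hf.lmarginal μ
  refine Filter.Eventually.and ?_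
    ((withDensity_absolutelyContinuous _ f).ae_le (ae_lmarginal_ne_top hf hfi s))
  set g : (∀ i, X i) → ℝ≥0∞ := {ω | m ω = 0}.indicator (fun _ => 1) with hg
  have hset : MeasurableSet {ω | m ω = 0} := hmm (measurableSet_singleton _)
  have hgm : Measurable g := measurable_const.indicator hset
  have hdep : DependsOn m ((sᶜ : Finset δ) : Set δ) := fun a b hab =>
    lmarginal_congr μ f fun i hi => hab i (by simpa using hi)
  have hgdep : DependsOn g ((sᶜ : Finset δ) : Set δ) := fun a b hab => by
    have := hdep hab
    simp [hg, Set.indicator, this]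
  have hz : ∫⁻ a, (f * g) a ∂Measure.pi μ = 0 := by
    refine lintegral_eq_zero_of_lmarginal (hf.mul hgm) s fun ω => ?_
    rw [lmarginal_mul_of_dependsOn hf hgdep disjoint_compl_left, ← hm]
    by_cases h : m ω = 0 <;> simp [hg, h]
  rw [lintegral_eq_zero_iff (hf.mul hgm)] at hz
  rw [ae_withDensity_iff hf]
  filter_upwards [hz] with ω hω hfω h
  simp [hg, h, hfω] at hω

/-- The integral form of the non-negativity of conditional mutual information.  If `s`, `t` are
disjoint sets of coordinates, then `A * B / (q_{sᶜ} * D)` has integral at most `1` with respect to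
the density `q`, as soon as `D` bounds the marginal of `A` with the coordinates in `t` integrated
out, and `B`, which does not depend on these, is a subprobability density in the remaining
coordinates. -/
theorem lintegral_mul_ratio_le {q A B D : (∀ i, X i) → ℝ≥0∞} {a b d s t v : Finset δ}
    (hq : Measurable q) (hA : Measurable A) (hB : Measurable B) (hD : Measurable D)
    (hAd : DependsOn A (a : Set δ)) (hBd : DependsOn B (b : Set δ)) (hDd : DependsOn D (d : Set δ))
    (has : Disjoint a s) (hbs : Disjoint (b ∪ d) (s ∪ t)) (hst : Disjoint s t)
    (hv : v = (s ∪ t)ᶜ)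
    (hAD : lmarginal μ t A ≤ D) (hB1 : lmarginal μ v B ≤ 1) :
    ∫⁻ ω, q ω * (A ω * B ω / (lmarginal μ s q ω * D ω)) ∂Measure.pi μ ≤ 1 := by
  rcases isEmpty_or_nonempty (∀ i, X i) with _ | ⟨⟨ω₀⟩⟩
  · simp [lintegral_of_isEmpty]
  subst hv
  have hbd := Finset.disjoint_union_right.1 hbs
  have hbd1 := Finset.disjoint_union_left.1 hbd.1
  have hbd2 := Finset.disjoint_union_left.1 hbd.2
  set T := lmarginal μ s q with hT
  have hTm : Measurable T := hq.lmarginal μ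
  have hTd : DependsOn T ((sᶜ : Finset δ) : Set δ) := fun a b hab =>
    lmarginal_congr μ q fun i hi => hab i (by simpa using hi)
  set g : (∀ i, X i) → ℝ≥0∞ := fun ω => A ω * B ω / (T ω * D ω) with hg
  have hgm : Measurable g := (hA.mul hB).div (hTm.mul hD)
  have hgd : DependsOn g ((sᶜ : Finset δ) : Set δ) := by
    intro x y hxy
    have hsub : ∀ {c : Finset δ}, Disjoint c s → ∀ i ∈ (c : Set δ), x i = y i := fun hc i hi =>
      hxy i (by simpa using Finset.disjoint_left.1 hc hi)
    simp only [hg]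
    rw [hAd (hsub has), hBd (hsub hbd1.1), hDd (hsub hbd1.2), hTd hxy]
  have h1 : lmarginal μ s (q * g) ≤ A * (B / D) := by
    rw [lmarginal_mul_of_dependsOn hq hgd disjoint_compl_left, ← hT]
    intro ω
    simp only [Pi.mul_apply, Pi.div_apply, hg]
    by_cases h0 : T ω = 0
    · simp [h0]
    by_cases hi : T ω = ∞
    · by_cases hd : D ω = 0
      · simp [hi, hd]
        by_cases hAB : A ω * B ω = 0
        · simp [hAB]
        · rcases eq_or_ne (A ω) 0 with h | h
          · simp [h] at hAB
          rcases eq_or_ne (B ω) 0 with h' | h'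
          · simp [h'] at hAB
          simp [ENNReal.div_zero h', ENNReal.mul_top h]
      · simp [hi, hd]
    · rw [div_eq_mul_inv, ENNReal.mul_inv (Or.inl h0) (Or.inl hi), div_eq_mul_inv]
      calc T ω * (A ω * B ω * ((T ω)⁻¹ * (D ω)⁻¹))
          = (T ω * (T ω)⁻¹) * (A ω * (B ω * (D ω)⁻¹)) := by ring
        _ ≤ 1 * (A ω * (B ω * (D ω)⁻¹)) := by gcongr; exact ENNReal.mul_inv_le_one _
        _ = _ := one_mul _
  have hBDd : DependsOn (B / D) ((b ∪ d : Finset δ) : Set δ) := by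
    intro x y hxy
    simp only [Pi.div_apply]
    rw [hBd fun i hi => hxy i (by simp_all), hDd fun i hi => hxy i (by simp_all)]
  have h2 : lmarginal μ t (A * (B / D)) ≤ B := by
    rw [lmarginal_mul_of_dependsOn hA hBDd hbd.2]
    intro ω
    simp only [Pi.mul_apply, Pi.div_apply]
    calc lmarginal μ t A ω * (B ω / D ω) ≤ D ω * (B ω / D ω) := by gcongr; exact hAD ω
      _ ≤ B ω := ENNReal.mul_div_le
  calc ∫⁻ ω, q ω * g ω ∂Measure.pi μ
      = lmarginal μ (s ∪ t)ᶜ (lmarginal μ t (lmarginal μ s (q * g))) ω₀ := by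
        rw [lmarginal_lmarginal (hq.mul hgm) t s (s ∪ t) hst.symm (Finset.union_comm _ _),
          lmarginal_compl_lmarginal (hq.mul hgm)]
        rfl
    _ ≤ lmarginal μ (s ∪ t)ᶜ B ω₀ :=
        lmarginal_mono ((lmarginal_mono h1).trans h2) ω₀
    _ ≤ 1 := hB1 ω₀

end Lmarginal

/-! ### A conditionally independent copy of a variable -/

section Copy

variable {α : Var → Type*}

/-- The original variables. -/
def original (ω : ∀ j : Option Var, α (j.getD Var.w)) : ∀ i, α i := fun i => ω (some i)

/-- The original variables, except that `A_w` is replaced by its copy. -/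
def copied (ω : ∀ j : Option Var, α (j.getD Var.w)) : ∀ i, α i :=
  Function.update (original ω) Var.w (ω none)

theorem dependsOn_comp_original {f : (∀ i, α i) → ℝ≥0∞} {A : Finset Var}
    (hf : DependsOn f (A : Set Var)) :
    DependsOn (f ∘ original) ((A.image some : Finset (Option Var)) : Set (Option Var)) :=
  fun a b hab => hf fun i hi => hab (some i) (by simpa using hi)

theorem dependsOn_comp_copied {f : (∀ i, α i) → ℝ≥0∞} {A : Finset Var}
    (hf : DependsOn f (A : Set Var)) :
    DependsOn (f ∘ copied)
      ((insert none ((A.erase Var.w).image some) : Finset (Option Var)) : Set (Option Var)) := by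
  intro a b hab
  refine hf fun i hi => ?_
  by_cases h : i = Var.w
  · subst h
    simpa [copied] using hab none (by simp)
  · simpa [copied, h, original] using hab (some i) (by simpa [h] using hi)

variable [∀ i, MeasurableSpace (α i)]

@[fun_prop]
theorem measurable_original : Measurable (original (α := α)) :=
  measurable_pi_iff.2 fun i => measurable_pi_apply (some i)

@[fun_prop]
theorem measurable_copied : Measurable (copied (α := α)) := by
  refine measurable_pi_iff.2 fun i => ?_
  by_cases h : i = Var.w
  · subst h
    simpa [copied] using measurable_pi_apply (none : Option Var)
  · simpa [copied, h, original] using measurable_pi_apply (some i)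

variable (ν : ∀ i, Measure (α i))

/-- The reference measures of the variables `A_i`, `i : Var`, and of a further variable, indexed by
`none`, which takes its values in the same space as `A_w`. -/
abbrev copyMeasure (j : Option Var) : Measure (α (j.getD Var.w)) := ν (j.getD Var.w)

theorem lmarginal_none_comp_copied (f : (∀ i, α i) → ℝ≥0∞) :
    lmarginal (copyMeasure ν) {none} (f ∘ copied) = lmarginal ν {Var.w} f ∘ copied := by
  rw [lmarginal_singleton, lmarginal_singleton]
  funext ω
  simp only [comp_apply]
  refine lintegral_congr fun t => ?_
  congr 1
  simp only [copied, Function.update_self, Function.update_idem]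
  rfl

theorem lmarginal_some_comp_copied (f : (∀ i, α i) → ℝ≥0∞) {i : Var} (hi : i ≠ Var.w) :
    lmarginal (copyMeasure ν) {some i} (f ∘ copied) = lmarginal ν {i} f ∘ copied := by
  rw [lmarginal_singleton, lmarginal_singleton]
  funext ω
  simp only [comp_apply]
  refine lintegral_congr fun t => ?_
  congr 1
  have : original (Function.update ω (some i) t) = Function.update (original ω) i t := by
    funext k
    by_cases hk : k = i
    · subst hk; simp [original]
    · simp [original, hk]
  simp only [copied, this]
  rw [Function.update_comm hi]
  congr 1

theorem lmarginal_w_comp_copied (f : (∀ i, α i) → ℝ≥0∞) {s : Finset Var} (hs : Var.w ∈ s) :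
    lmarginal ν s f ∘ copied = lmarginal ν s f ∘ original := by
  funext ω
  simp only [comp_apply, copied]
  exact lmarginal_update_of_mem ν hs f _ _

/-- The density of the variables together with a copy of `A_w` that, given `(A_y, A_z)`, is
independent of the original variables and distributed as `A_w`.  It is `0` where the density of
`(A_y, A_z)` is infinite; `p` vanishes almost everywhere where that density is `0`. -/
noncomputable def copyDensity (p : (∀ i, α i) → ℝ≥0∞)
    (ω : ∀ j : Option Var, α (j.getD Var.w)) : ℝ≥0∞ :=
  p (original ω) * (lmarginal ν {Var.x} p (copied ω) / lmarginal ν {Var.w, Var.x} p (original ω))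

variable {ν}

theorem dependsOn_lmarginal_univ (p : (∀ i, α i) → ℝ≥0∞) (s : Finset Var) {t : Finset Var}
    (ht : univ \ s = t) : DependsOn (lmarginal ν s p) (t : Set Var) := by
  rw [← ht]
  exact dependsOn_lmarginal (by simpa using dependsOn_univ p) s

theorem dependsOn_original (p : (∀ i, α i) → ℝ≥0∞) (s : Finset Var) {A : Finset (Option Var)}
    (hA : (univ \ s).image some = A) :
    DependsOn (lmarginal ν s p ∘ original) (A : Set (Option Var)) :=
  hA ▸ dependsOn_comp_original (dependsOn_lmarginal_univ p s rfl)

theorem dependsOn_copied (p : (∀ i, α i) → ℝ≥0∞) (s : Finset Var) {A : Finset (Option Var)}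
    (hA : insert none (((univ \ s).erase Var.w).image some) = A) :
    DependsOn (lmarginal ν s p ∘ copied) (A : Set (Option Var)) :=
  hA ▸ dependsOn_comp_copied (dependsOn_lmarginal_univ p s rfl)

theorem dependsOn_lmarginal_copyDensity (p : (∀ i, α i) → ℝ≥0∞) (s : Finset (Option Var))
    {A : Finset (Option Var)} (hA : univ \ s = A) :
    DependsOn (lmarginal (copyMeasure ν) s (copyDensity ν p)) (A : Set (Option Var)) := by
  rw [← hA]
  exact dependsOn_lmarginal (by simpa using dependsOn_univ _) s

variable [∀ i, SigmaFinite (ν i)] {p : (∀ i, α i) → ℝ≥0∞}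

theorem lmarginal_comp_original (ν : ∀ i, Measure (α i)) [∀ i, SigmaFinite (ν i)]
    {f : (∀ i, α i) → ℝ≥0∞} (hf : Measurable f) (s : Finset Var) :
    lmarginal (copyMeasure ν) (s.image some) (f ∘ original) = lmarginal ν s f ∘ original := by
  funext ω
  exact lmarginal_image (X := fun j : Option Var => α (j.getD Var.w)) (μ := copyMeasure ν)
    (e := some) (Option.some_injective _) s hf ω

theorem measurable_copyDensity (hp : Measurable p) : Measurable (copyDensity ν p) :=
  (hp.comp measurable_original).mul (((hp.lmarginal ν).comp measurable_copied).div
    ((hp.lmarginal ν).comp measurable_original))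

theorem lmarginal_none_copyDensity_mul (hp : Measurable p) (g : (∀ i, α i) → ℝ≥0∞) :
    lmarginal (copyMeasure ν) {none} (copyDensity ν p * (g ∘ original)) =
      fun ω => p (original ω) * g (original ω) * (lmarginal ν {Var.w, Var.x} p (original ω) /
        lmarginal ν {Var.w, Var.x} p (original ω)) := by
  have h1 : copyDensity ν p * (g ∘ original) = (lmarginal ν {Var.x} p ∘ copied) *
      ((p * g / lmarginal ν {Var.w, Var.x} p) ∘ original) := by
    funext ω
    simp only [copyDensity, div_eq_mul_inv, Pi.mul_apply, Pi.inv_apply, comp_apply]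
    ring
  rw [h1, lmarginal_mul_of_dependsOn (A := univ.image some) ((hp.lmarginal ν).comp measurable_copied)
    (dependsOn_comp_original (by simpa using dependsOn_univ _)) (by decide),
    lmarginal_none_comp_copied, lmarginal_lmarginal hp {Var.w} {Var.x} _ (by decide) rfl,
    lmarginal_w_comp_copied ν p (by decide)]
  funext ω
  simp only [div_eq_mul_inv, Pi.mul_apply, Pi.inv_apply, comp_apply, Finset.singleton_union]
  ring

theorem lmarginal_image_some_comp_original {f : (∀ i, α i) → ℝ≥0∞} (hf : Measurable f)
    (ω : ∀ j : Option Var, α (j.getD Var.w)) :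
    lmarginal (copyMeasure ν) (univ.image some) (f ∘ original) ω = ∫⁻ a, f a ∂Measure.pi ν := by
  rw [lmarginal_comp_original ν hf, lmarginal_univ]
  rfl

/-- Integration over all coordinates, one of the two blocks first. -/
theorem lintegral_copy (ω : ∀ j : Option Var, α (j.getD Var.w))
    {f : (∀ j : Option Var, α (j.getD Var.w)) → ℝ≥0∞} (hf : Measurable f)
    (s t : Finset (Option Var)) (hst : Disjoint s t) (h : s ∪ t = univ) :
    ∫⁻ a, f a ∂Measure.pi (copyMeasure ν) =
      lmarginal (copyMeasure ν) s (lmarginal (copyMeasure ν) t f) ω := by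
  rw [lmarginal_lmarginal hf s t univ hst h, lmarginal_univ]

theorem lintegral_original_le (hp : Measurable p) {g : (∀ i, α i) → ℝ≥0∞} (hg : Measurable g) :
    ∫⁻ ω, copyDensity ν p ω * g (original ω) ∂Measure.pi (copyMeasure ν) ≤
      ∫⁻ a, p a * g a ∂Measure.pi ν := by
  rcases isEmpty_or_nonempty (∀ j : Option Var, α (j.getD Var.w)) with _ | ⟨⟨ω⟩⟩
  · simp [lintegral_of_isEmpty]
  have hm : Measurable (copyDensity ν p * (g ∘ original)) :=
    (measurable_copyDensity hp).mul (hg.comp measurable_original)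
  calc ∫⁻ ω, copyDensity ν p ω * g (original ω) ∂Measure.pi (copyMeasure ν)
      = lmarginal (copyMeasure ν) (univ.image some) (lmarginal (copyMeasure ν) {none}
          (copyDensity ν p * (g ∘ original))) ω :=
        lintegral_copy ω hm (univ.image some) {none} (by decide) (by decide)
    _ ≤ lmarginal (copyMeasure ν) (univ.image some) ((p * g) ∘ original) ω := by
        refine lmarginal_mono ?_ ω
        rw [lmarginal_none_copyDensity_mul hp g]
        intro a
        exact mul_le_of_le_one_right' ENNReal.div_self_le_one
    _ = _ := lmarginal_image_some_comp_original (hp.mul hg) ω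

theorem lmarginal_copied_wyz (h : (∀ i, α i) → ℝ≥0∞) (hh : Measurable h) :
    lmarginal (copyMeasure ν) {none, some Var.y, some Var.z} (h ∘ copied) =
      lmarginal ν {Var.w, Var.y, Var.z} h ∘ copied := by
  have hc := hh.comp (measurable_copied (α := α))
  rw [← lmarginal_lmarginal hc {none} {some Var.y, some Var.z} {none, some Var.y, some Var.z} (by decide) rfl,
    ← lmarginal_lmarginal hc {some Var.y} {some Var.z} {some Var.y, some Var.z} (by decide) rfl,
    lmarginal_some_comp_copied ν h (by decide), lmarginal_some_comp_copied ν _ (by decide),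
    lmarginal_none_comp_copied,
    lmarginal_lmarginal hh {Var.y} {Var.z} {Var.y, Var.z} (by decide) rfl,
    lmarginal_lmarginal hh {Var.w} {Var.y, Var.z} {Var.w, Var.y, Var.z} (by decide) rfl]

/-- With the original `A_w` and `A_x` integrated out, the extended density is at most that of
`(A_w, A_y, A_z)`, evaluated at the copy. -/
theorem lmarginal_wx_copyDensity_mul_le (hp : Measurable p) {g : (∀ i, α i) → ℝ≥0∞}
    (hgd : DependsOn g (({Var.w, Var.y, Var.z} : Finset Var) : Set Var)) :
    lmarginal (copyMeasure ν) {some Var.w, some Var.x} (copyDensity ν p * (g ∘ copied)) ≤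
      (lmarginal ν {Var.x} p * g) ∘ copied := by
  have hX : DependsOn ((lmarginal ν {Var.x} p * g) ∘ copied)
      ((insert none (({Var.w, Var.y, Var.z} : Finset Var).erase Var.w |>.image some) :
        Finset (Option Var)) : Set (Option Var)) := by
    refine dependsOn_comp_copied (A := {Var.w, Var.y, Var.z}) fun a b hab => ?_
    simp only [Pi.mul_apply]
    rw [hgd hab, dependsOn_lmarginal_univ p {Var.x} (by decide) hab]
  have hY := dependsOn_comp_original
    (dependsOn_lmarginal_univ (ν := ν) p {Var.w, Var.x} (t := {Var.y, Var.z}) (by decide))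
  have h1 : copyDensity ν p * (g ∘ copied) = (p ∘ original) *
      (((lmarginal ν {Var.x} p * g) ∘ copied) / (lmarginal ν {Var.w, Var.x} p ∘ original)) := by
    funext ω
    simp only [copyDensity, div_eq_mul_inv, Pi.mul_apply, Pi.inv_apply, comp_apply]
    ring
  rw [h1, lmarginal_mul_of_dependsOn (A := {none, some Var.y, some Var.z})
    (hp.comp measurable_original) (fun a b hab => ?_) (by decide)]
  · have := lmarginal_comp_original ν hp {Var.w, Var.x}
    rw [show ({some Var.w, some Var.x} : Finset (Option Var)) =
      ({Var.w, Var.x} : Finset Var).image some from by decide, this]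
    intro ω
    simp only [Pi.mul_apply, comp_apply, Pi.div_apply]
    exact ENNReal.mul_div_le
  · simp only [Pi.div_apply]
    rw [hX fun i hi => hab i (by revert hi; rw [Finset.mem_coe, Finset.mem_coe]; revert i; decide),
      hY fun i hi => hab i (by revert hi; rw [Finset.mem_coe, Finset.mem_coe]; revert i; decide)]

theorem lintegral_copied_le (hp : Measurable p) {g : (∀ i, α i) → ℝ≥0∞} (hg : Measurable g)
    (hgd : DependsOn g (({Var.w, Var.y, Var.z} : Finset Var) : Set Var)) :
    ∫⁻ ω, copyDensity ν p ω * g (copied ω) ∂Measure.pi (copyMeasure ν) ≤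
      ∫⁻ a, p a * g a ∂Measure.pi ν := by
  rcases isEmpty_or_nonempty (∀ j : Option Var, α (j.getD Var.w)) with _ | ⟨⟨ω⟩⟩
  · simp [lintegral_of_isEmpty]
  have hm : Measurable (copyDensity ν p * (g ∘ copied)) :=
    (measurable_copyDensity hp).mul (hg.comp measurable_copied)
  calc ∫⁻ ω, copyDensity ν p ω * g (copied ω) ∂Measure.pi (copyMeasure ν)
      = lmarginal (copyMeasure ν) {none, some Var.y, some Var.z}
          (lmarginal (copyMeasure ν) {some Var.w, some Var.x}
            (copyDensity ν p * (g ∘ copied))) ω :=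
        lintegral_copy ω hm _ _ (by decide) (by decide)
    _ ≤ lmarginal (copyMeasure ν) {none, some Var.y, some Var.z}
          ((lmarginal ν {Var.x} p * g) ∘ copied) ω :=
        lmarginal_mono (lmarginal_wx_copyDensity_mul_le hp hgd) ω
    _ = _ := by
        rw [lmarginal_copied_wyz _ ((hp.lmarginal ν).mul hg),
          ← lmarginal_mul_of_dependsOn hp hgd (by decide), comp_apply,
          lmarginal_lmarginal (hp.mul hg) _ _ univ (by decide) (by decide), lmarginal_univ]
        rfl

theorem lintegral_copyDensity (hp : Measurable p) (hp1 : ∫⁻ a, p a ∂Measure.pi ν = 1) :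
    ∫⁻ ω, copyDensity ν p ω ∂Measure.pi (copyMeasure ν) = 1 := by
  rcases isEmpty_or_nonempty (∀ j : Option Var, α (j.getD Var.w)) with h | ⟨⟨ω⟩⟩
  · have : IsEmpty (∀ i, α i) := ⟨fun a => h.false fun j => a (j.getD Var.w)⟩
    simp [lintegral_of_isEmpty] at hp1
  set D := lmarginal ν {Var.w, Var.x} p with hD
  have hDm : Measurable D := hp.lmarginal ν
  have h1 : lmarginal (copyMeasure ν) {none} (copyDensity ν p) = (p * (D / D)) ∘ original := by
    have := lmarginal_none_copyDensity_mul (ν := ν) hp 1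
    rw [show copyDensity ν p * ((1 : (∀ i, α i) → ℝ≥0∞) ∘ original) = copyDensity ν p from
      mul_one _] at this
    rw [this]
    funext a
    simp [hD]
  rw [lintegral_copy ω (measurable_copyDensity hp) (univ.image some) {none} (by decide) (by decide),
    h1, lmarginal_image_some_comp_original (hp.mul (hDm.div hDm))]
  have hP : ∀ᵐ a ∂(Measure.pi ν).withDensity p, (D / D) a = 1 := by
    filter_upwards [ae_withDensity_lmarginal hp (by simp [hp1]) {Var.w, Var.x}] with a ha
    exact ENNReal.div_self ha.1 ha.2
  rw [ae_withDensity_iff hp] at hP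
  rw [← hp1]
  refine lintegral_congr_ae ?_
  filter_upwards [hP] with a ha
  by_cases h : p a = 0
  · simp [h]
  · simp only [Pi.mul_apply, ha h, mul_one]

/-- The law of the extended variables. -/
noncomputable def copyLaw (ν : ∀ i, Measure (α i)) [∀ i, SigmaFinite (ν i)]
    (p : (∀ i, α i) → ℝ≥0∞) : Measure (∀ j : Option Var, α (j.getD Var.w)) :=
  (Measure.pi (copyMeasure ν)).withDensity (copyDensity ν p)

theorem isProbabilityMeasure_withDensity {Ω : Type*} [MeasurableSpace Ω] {μ : Measure Ω}
    {f : Ω → ℝ≥0∞} (h : ∫⁻ a, f a ∂μ = 1) : IsProbabilityMeasure (μ.withDensity f) :=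
  ⟨by rw [withDensity_apply _ MeasurableSet.univ, Measure.restrict_univ, h]⟩

/-- The original variables have their own law as marginal of the extended law. -/
theorem map_original_copyLaw (hp : Measurable p) (hp1 : ∫⁻ a, p a ∂Measure.pi ν = 1) :
    (copyLaw ν p).map original = (Measure.pi ν).withDensity p := by
  have := isProbabilityMeasure_withDensity hp1
  have : IsProbabilityMeasure (copyLaw ν p) :=
    isProbabilityMeasure_withDensity (lintegral_copyDensity hp hp1)
  have := Measure.isProbabilityMeasure_map (μ := copyLaw ν p)
    (measurable_original (α := α)).aemeasurable
  refine Measure.eq_of_le_of_isProbabilityMeasure (Measure.le_iff.2 fun s hs => ?_)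
  have hg : Measurable (s.indicator (1 : (∀ i, α i) → ℝ≥0∞)) := measurable_one.indicator hs
  rw [← lintegral_indicator_one hs, ← lintegral_indicator_one hs, lintegral_map hg
    measurable_original, lintegral_withDensity_eq_lintegral_mul _ hp hg]
  exact (lintegral_withDensity_eq_lintegral_mul _ (measurable_copyDensity hp)
    (hg.comp measurable_original)).trans_le (lintegral_original_le hp hg)

/-- A function of `(A_w, A_y, A_z)` does not change its law when `A_w` is replaced by its copy. -/
theorem map_copied_copyLaw (hp : Measurable p) (hp1 : ∫⁻ a, p a ∂Measure.pi ν = 1)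
    {g : (∀ i, α i) → ℝ≥0∞} (hg : Measurable g)
    (hgd : DependsOn g (({Var.w, Var.y, Var.z} : Finset Var) : Set Var)) :
    (copyLaw ν p).map (g ∘ copied) = ((Measure.pi ν).withDensity p).map g := by
  have := isProbabilityMeasure_withDensity hp1
  have : IsProbabilityMeasure (copyLaw ν p) :=
    isProbabilityMeasure_withDensity (lintegral_copyDensity hp hp1)
  have hgc : Measurable (g ∘ copied) := hg.comp measurable_copied
  have := Measure.isProbabilityMeasure_map (μ := copyLaw ν p) hgc.aemeasurable
  have := Measure.isProbabilityMeasure_map (μ := (Measure.pi ν).withDensity p) hg.aemeasurable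
  refine Measure.eq_of_le_of_isProbabilityMeasure (Measure.le_iff.2 fun s hs => ?_)
  have hi : Measurable (s.indicator (1 : ℝ≥0∞ → ℝ≥0∞)) := measurable_one.indicator hs
  rw [← lintegral_indicator_one hs, ← lintegral_indicator_one hs, lintegral_map hi hgc,
    lintegral_map hi hg]
  refine ((lintegral_withDensity_eq_lintegral_mul _ (measurable_copyDensity hp)
    (hi.comp hgc)).trans_le (lintegral_copied_le hp (hi.comp hg) fun a b hab => ?_)).trans_eq
    (lintegral_withDensity_eq_lintegral_mul _ hp (hi.comp hg)).symm
  simp only [comp_apply]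
  rw [hgd hab]

end Copy

/-! ### The Zhang–Yeung inequality for densities -/

/-- If the expectations of the `r k` are at most `1`, then the expectation of the sum of their
logarithms is not positive, since `log r ≤ r - 1`.  Only the sum needs to be integrable. -/
theorem integral_nonpos_of_le_sum_log {Ω ι : Type*} [MeasurableSpace Ω] [Fintype ι]
    {Q : Measure Ω} [IsProbabilityMeasure Q] {r : ι → Ω → ℝ≥0∞} (hm : ∀ k, Measurable (r k))
    (hr : ∀ k, ∫⁻ ω, r k ω ∂Q ≤ 1) (hpos : ∀ᵐ ω ∂Q, ∀ k, r k ω ≠ 0) {L : Ω → ℝ}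
    (hL : Integrable L Q) (h : ∀ᵐ ω ∂Q, L ω ≤ ∑ k, Real.log (r k ω).toReal) :
    ∫ ω, L ω ∂Q ≤ 0 := by
  have hfin : ∀ k, ∫⁻ ω, r k ω ∂Q ≠ ∞ := fun k => ne_top_of_le_ne_top ENNReal.one_ne_top (hr k)
  have hint : ∀ k, Integrable (fun ω => (r k ω).toReal) Q := fun k =>
    integrable_toReal_of_lintegral_ne_top (hm k).aemeasurable (hfin k)
  have hlt : ∀ᵐ ω ∂Q, ∀ k, r k ω < ∞ := ae_all_iff.2 fun k => ae_lt_top (hm k) (hfin k)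
  calc ∫ ω, L ω ∂Q ≤ ∫ ω, ∑ k, ((r k ω).toReal - 1) ∂Q := by
        refine integral_mono_ae hL (integrable_finsetSum _ fun k _ =>
          (hint k).sub (integrable_const 1)) ?_
        filter_upwards [h, hpos, hlt] with ω h1 h2 h3
        refine h1.trans (Finset.sum_le_sum fun k _ => ?_)
        exact Real.log_le_sub_one_of_pos (ENNReal.toReal_pos (h2 k) (h3 k).ne)
    _ = ∑ k, (∫ ω, (r k ω).toReal ∂Q - 1) := by
        rw [integral_finsetSum (f := fun k ω => (r k ω).toReal - 1) _ fun k _ =>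
          (hint k).sub (integrable_const 1)]
        refine Finset.sum_congr rfl fun k _ => ?_
        rw [integral_sub (hint k) (integrable_const 1)]
        simp
    _ ≤ 0 := by
        refine Finset.sum_nonpos fun k _ => ?_
        rw [integral_toReal (hm k).aemeasurable (ae_lt_top (hm k) (hfin k))]
        have := ENNReal.toReal_mono ENNReal.one_ne_top (hr k)
        rw [ENNReal.toReal_one] at this
        linarith

theorem log_toReal_ratio {a b t d : ℝ≥0∞} (ha : a ≠ 0 ∧ a ≠ ∞) (hb : b ≠ 0 ∧ b ≠ ∞)
    (ht : t ≠ 0 ∧ t ≠ ∞) (hd : d ≠ 0 ∧ d ≠ ∞) :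
    Real.log (a * b / (t * d)).toReal =
      Real.log a.toReal + Real.log b.toReal - Real.log t.toReal - Real.log d.toReal := by
  have h : ∀ {c : ℝ≥0∞}, c ≠ 0 ∧ c ≠ ∞ → c.toReal ≠ 0 := fun h => (ENNReal.toReal_pos h.1 h.2).ne'
  rw [ENNReal.toReal_div, ENNReal.toReal_mul, ENNReal.toReal_mul,
    Real.log_div (mul_ne_zero (h ha) (h hb)) (mul_ne_zero (h ht) (h hd)),
    Real.log_mul (h ha) (h hb), Real.log_mul (h ht) (h hd)]
  ring

theorem log_toReal_mul_div {a b d : ℝ≥0∞} (ha : a ≠ 0 ∧ a ≠ ∞) (hb : b ≠ 0 ∧ b ≠ ∞)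
    (hd : d ≠ 0 ∧ d ≠ ∞) : Real.log (a * (b / d)).toReal =
      Real.log a.toReal + Real.log b.toReal - Real.log d.toReal := by
  have h : ∀ {c : ℝ≥0∞}, c ≠ 0 ∧ c ≠ ∞ → c.toReal ≠ 0 := fun h => (ENNReal.toReal_pos h.1 h.2).ne'
  rw [ENNReal.toReal_mul, ENNReal.toReal_div, Real.log_mul (h ha) (div_ne_zero (h hb) (h hd)),
    Real.log_div (h hb) (h hd)]
  ring

section Main

variable {α : Var → Type*} [∀ i, MeasurableSpace (α i)] {ν : ∀ i, Measure (α i)}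
  [∀ i, SigmaFinite (ν i)] {p : (∀ i, α i) → ℝ≥0∞}

theorem lmarginal_original_lmarginal (hp : Measurable p) (t s u : Finset Var)
    (hst : Disjoint t s) (hu : t ∪ s = u) {t' : Finset (Option Var)} (ht : t.image some = t') :
    lmarginal (copyMeasure ν) t' (lmarginal ν s p ∘ original) = lmarginal ν u p ∘ original := by
  rw [← ht, lmarginal_comp_original ν (hp.lmarginal ν), lmarginal_lmarginal hp t s u hst hu]

/-- Integrating out the copy of `A_w` and `A_i`. -/
theorem lmarginal_copied_pair (hp : Measurable p) (hp1 : ∫⁻ a, p a ∂Measure.pi ν = 1) {i : Var}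
    (hi : i ≠ Var.w) (s : Finset Var) (hs : {Var.w, i} ∪ s = univ) (hd : Disjoint {Var.w, i} s) :
    lmarginal (copyMeasure ν) {none, some i} (lmarginal ν s p ∘ copied) ≤ 1 := by
  have hm := hp.lmarginal (s := s) ν
  rw [← lmarginal_lmarginal (hm.comp measurable_copied) {none} {some i} {none, some i} (by simp)
    rfl, lmarginal_some_comp_copied ν _ hi, lmarginal_none_comp_copied,
    lmarginal_lmarginal hm {Var.w} {i} {Var.w, i} (by simpa using hi.symm) rfl,
    lmarginal_lmarginal hp _ _ univ hd hs, lmarginal_univ, hp1]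
  exact le_refl _

theorem lmarginal_compl_copyDensity_le (hp : Measurable p) (hp1 : ∫⁻ a, p a ∂Measure.pi ν = 1)
    (s v : Finset (Option Var)) (hd : Disjoint v s) (hv : v ∪ s = univ) :
    lmarginal (copyMeasure ν) v (lmarginal (copyMeasure ν) s (copyDensity ν p)) ≤ 1 := by
  rw [lmarginal_lmarginal (measurable_copyDensity hp) v s univ hd hv, lmarginal_univ,
    lintegral_copyDensity hp hp1]
  exact le_refl _

/-- Given `(A_y, A_z)`, the copy is independent of `A_w` and of `A_x`. -/
theorem lmarginal_singleton_copyDensity (hp : Measurable p) {i : Var}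
    (hi : i ∈ ({Var.w, Var.x} : Finset Var)) :
    lmarginal (copyMeasure ν) {some i} (copyDensity ν p) = (lmarginal ν {i} p ∘ original) *
      ((lmarginal ν {Var.x} p ∘ copied) / (lmarginal ν {Var.w, Var.x} p ∘ original)) := by
  have hX : DependsOn (lmarginal ν {Var.x} p ∘ copied)
      (({none, some Var.y, some Var.z} : Finset (Option Var)) : Set (Option Var)) :=
    dependsOn_copied p _ (by decide)
  have hY : DependsOn (lmarginal ν {Var.w, Var.x} p ∘ original)
      (({some Var.y, some Var.z} : Finset (Option Var)) : Set (Option Var)) :=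
    dependsOn_original p _ (by decide)
  have h1 : copyDensity ν p = (p ∘ original) * ((lmarginal ν {Var.x} p ∘ copied) /
      (lmarginal ν {Var.w, Var.x} p ∘ original)) := rfl
  rw [h1, lmarginal_mul_of_dependsOn (A := {none, some Var.y, some Var.z})
    (hp.comp measurable_original) (fun a b hab => ?_) (by revert i; decide),
    ← lmarginal_comp_original ν hp {i}, Finset.image_singleton]
  · simp only [Pi.div_apply]
    rw [hX hab, hY fun i hi => hab i (by simp at hi ⊢; tauto)]

/-- The density of the copy is at most that of `A_w`. -/
theorem lmarginal_copyDensity_le (hp : Measurable p) :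
    lmarginal (copyMeasure ν) {some Var.w, some Var.x, some Var.y, some Var.z} (copyDensity ν p) ≤
      lmarginal ν {Var.x, Var.y, Var.z} p ∘ copied := by
  have h := lmarginal_wx_copyDensity_mul_le (ν := ν) hp (g := 1) (fun _ _ _ => rfl)
  have h1 : copyDensity ν p * ((1 : (∀ i, α i) → ℝ≥0∞) ∘ copied) = copyDensity ν p := mul_one _
  have hm := hp.lmarginal (s := {Var.x}) ν
  rw [h1, mul_one] at h
  rw [← lmarginal_lmarginal (measurable_copyDensity hp) {some Var.y, some Var.z}
    {some Var.w, some Var.x} _ (by decide) (by decide)]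
  refine (lmarginal_mono h).trans_eq ?_
  rw [← lmarginal_lmarginal (hm.comp measurable_copied) {some Var.y} {some Var.z}
    {some Var.y, some Var.z} (by decide) rfl,
    lmarginal_some_comp_copied ν _ (by decide), lmarginal_some_comp_copied ν _ (by decide),
    lmarginal_lmarginal hm {Var.y} {Var.z} {Var.y, Var.z} (by decide) rfl,
    lmarginal_lmarginal hp _ _ {Var.x, Var.y, Var.z} (by decide) (by decide)]

/-- The Zhang–Yeung inequality, for a probability density with respect to a product measure.  The
integrals are the negative entropies (in nats) of the variables that are not integrated out. -/
theorem zhangYeung_density (hp : Measurable p) (hp1 : ∫⁻ a, p a ∂Measure.pi ν = 1)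
    (hint : ∀ s, Integrable (fun a => Real.log (lmarginal ν s p a).toReal)
      ((Measure.pi ν).withDensity p)) {E : Finset Var → ℝ}
    (hE : ∀ s, E s = ∫ a, Real.log (lmarginal ν s p a).toReal ∂(Measure.pi ν).withDensity p) :
    - 4 * E {.x} - E {.w} - E {.y, .z} + 3 * E {.x, .z} + 3 * E {.x, .y} + E {.w, .z} + E {.w, .y}
      + 3 * E {.w, .x} - E {.x, .y, .z} - 2 * E {.w, .x, .z} - 2 * E {.w, .x, .y} ≤ 0 := by
  set q := copyDensity ν p with hq
  set Q := copyLaw ν p with hQ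
  have hqm : Measurable q := measurable_copyDensity hp
  have hq1 : ∫⁻ ω, q ω ∂Measure.pi (copyMeasure ν) = 1 := lintegral_copyDensity hp hp1
  have : IsProbabilityMeasure Q := isProbabilityMeasure_withDensity hq1
  -- the marginals of the original variables, of the variables with `A_w` replaced by its copy,
  -- and of all five variables
  let F : Finset Var → (∀ j : Option Var, α (j.getD Var.w)) → ℝ≥0∞ :=
    fun s => lmarginal ν s p ∘ original
  let U : Finset Var → (∀ j : Option Var, α (j.getD Var.w)) → ℝ≥0∞ :=
    fun s => lmarginal ν s p ∘ copied
  let G : Finset (Option Var) → (∀ j : Option Var, α (j.getD Var.w)) → ℝ≥0∞ :=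
    fun s => lmarginal (copyMeasure ν) s q
  have hFm : ∀ s, Measurable (F s) := fun s => (hp.lmarginal ν).comp measurable_original
  have hUm : ∀ s, Measurable (U s) := fun s => (hp.lmarginal ν).comp measurable_copied
  have hGm : ∀ s, Measurable (G s) := fun s => hqm.lmarginal _
  have hmap := map_original_copyLaw hp hp1
  have hmapU : ∀ s, Var.x ∈ s → Q.map (U s) =
      ((Measure.pi ν).withDensity p).map (lmarginal ν s p) := fun s hs =>
    map_copied_copyLaw hp hp1 (hp.lmarginal ν) ((dependsOn_lmarginal_univ p s rfl).mono (by
      intro i hi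
      have : i ≠ Var.x := by rintro rfl; simp [hs] at hi
      cases i <;> simp_all))
  have hpos := fun s => ae_withDensity_lmarginal (μ := ν) hp (by simp [hp1]) s
  have hset : MeasurableSet {t : ℝ≥0∞ | t ≠ 0 ∧ t ≠ ∞} :=
    (measurableSet_singleton _).compl.inter (measurableSet_singleton _).compl
  have hFpos : ∀ᵐ ω ∂Q, ∀ s, F s ω ≠ 0 ∧ F s ω ≠ ∞ := by
    rw [ae_all_iff]
    intro s
    have := hpos s
    rw [← hmap] at this
    exact ae_of_ae_map measurable_original.aemeasurable this
  have hUpos : ∀ᵐ ω ∂Q, ∀ s, Var.x ∈ s → U s ω ≠ 0 ∧ U s ω ≠ ∞ := by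
    rw [ae_all_iff]
    intro s
    by_cases hs : Var.x ∈ s
    · have h1 := (ae_map_iff (hp.lmarginal ν).aemeasurable hset).2 (hpos s)
      rw [← hmapU s hs] at h1
      filter_upwards [ae_of_ae_map (hUm s).aemeasurable h1] with ω h _ using h
    · simp [hs]
  have hGpos : ∀ᵐ ω ∂Q, ∀ s, G s ω ≠ 0 ∧ G s ω ≠ ∞ :=
    ae_all_iff.2 fun s => ae_withDensity_lmarginal hqm (by simp [hq1]) s
  have hlog : Measurable fun t : ℝ≥0∞ => Real.log t.toReal :=
    Real.measurable_log.comp ENNReal.measurable_toReal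
  have hFi : ∀ s, Integrable (fun ω => Real.log (F s ω).toReal) Q := fun s => by
    have := hint s
    rw [← hmap] at this
    exact this.comp_measurable measurable_original
  have hFE : ∀ s, ∫ ω, Real.log (F s ω).toReal ∂Q = E s := fun s => by
    rw [hE, ← hmap]
    exact (integral_map (f := fun a => Real.log (lmarginal ν s p a).toReal)
      measurable_original.aemeasurable (hlog.comp (hp.lmarginal ν)).aestronglyMeasurable).symm
  have hUi : ∀ s, Var.x ∈ s → Integrable (fun ω => Real.log (U s ω).toReal) Q := fun s hs => by
    have h1 := (integrable_map_measure (μ := (Measure.pi ν).withDensity p) (f := lmarginal ν s p)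
      hlog.aestronglyMeasurable (hp.lmarginal ν).aemeasurable).2 (hint s)
    rw [← hmapU s hs] at h1
    exact h1.comp_measurable (hUm s)
  have hUE : ∀ s, Var.x ∈ s → ∫ ω, Real.log (U s ω).toReal ∂Q = E s := fun s hs => by
    rw [hE, ← integral_map (f := fun t : ℝ≥0∞ => Real.log t.toReal) (hUm s).aemeasurable
      hlog.aestronglyMeasurable, hmapU s hs, integral_map (hp.lmarginal ν).aemeasurable
      hlog.aestronglyMeasurable]
  let r : Fin 8 → (∀ j : Option Var, α (j.getD Var.w)) → ℝ≥0∞ := ![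
    -- `I(w; x | r) ≥ 0`, where `r` is the copy of `w`
    fun ω => G {some .x, some .y, some .z} ω * G {some .w, some .y, some .z} ω /
      (G {some .y, some .z} ω * U {.x, .y, .z} ω),
    -- `I(y; z | r w) ≥ 0`, `I(r; w | y) ≥ 0`, `I(r; w | z) ≥ 0`
    fun ω => G {some .x, some .z} ω * G {some .x, some .y} ω /
      (G {some .x} ω * G {some .x, some .y, some .z} ω),
    fun ω => F {.x, .z} ω * U {.x, .z} ω / (G {some .x, some .z} ω * F {.w, .x, .z} ω),
    fun ω => F {.x, .y} ω * U {.x, .y} ω / (G {some .x, some .y} ω * F {.w, .x, .y} ω),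
    -- `I(y; z | r x) ≥ 0`, `I(r; x | y) ≥ 0`, `I(r; x | z) ≥ 0`
    fun ω => G {some .w, some .z} ω * G {some .w, some .y} ω /
      (G {some .w} ω * G {some .w, some .y, some .z} ω),
    fun ω => F {.w, .z} ω * U {.x, .z} ω / (G {some .w, some .z} ω * F {.w, .x, .z} ω),
    fun ω => F {.w, .y} ω * U {.x, .y} ω / (G {some .w, some .y} ω * F {.w, .x, .y} ω),
    -- `I(r; y z | w x) ≥ 0`
    fun ω => F ∅ ω * G {some .y, some .z} ω / (G ∅ ω * F {.y, .z} ω)]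
  have hrm : ∀ k, Measurable (r k) := by
    intro k
    fin_cases k <;>
      exact ((by first | exact hFm _ | exact hGm _ : Measurable _).mul
        (by first | exact hUm _ | exact hGm _ : Measurable _)).div ((hGm _).mul
        (by first | exact hFm _ | exact hGm _ | exact hUm _ : Measurable _))
  have hFd := fun s => dependsOn_original (ν := ν) p s rfl
  have hUd := fun s => dependsOn_copied (ν := ν) p s rfl
  have hGd := fun s => dependsOn_lmarginal_copyDensity (ν := ν) p s rfl
  have hr : ∀ k, ∫⁻ ω, r k ω ∂Q ≤ 1 := by
    intro k
    rw [hQ, copyLaw, lintegral_withDensity_eq_lintegral_mul _ hqm (hrm k)]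
    fin_cases k
    · exact lintegral_mul_ratio_le (t := {some .w}) (v := {none, some .x}) hqm (hGm _) (hGm _)
        (hUm _) (hGd _) (hGd _) (hUd _) (by decide) (by decide) (by decide) (by decide)
        ((lmarginal_lmarginal hqm {some .w} _ _ (by decide) rfl).trans_le
          (lmarginal_copyDensity_le hp))
        (lmarginal_compl_copyDensity_le hp hp1 _ _ (by decide) (by decide))
    · exact lintegral_mul_ratio_le (t := {some .y}) (v := {none, some .w, some .z}) hqm (hGm _)
        (hGm _) (hGm _) (hGd _) (hGd _) (hGd _) (by decide) (by decide) (by decide) (by decide)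
        (lmarginal_lmarginal hqm {some .y} _ _ (by decide) (by decide)).le
        (lmarginal_compl_copyDensity_le hp hp1 _ _ (by decide) (by decide))
    · exact lintegral_mul_ratio_le (t := {some .w}) (v := {none, some .y}) hqm (hFm _)
        (hUm _) (hFm _) (hFd _) (hUd _) (hFd _) (by decide) (by decide) (by decide) (by decide)
        (lmarginal_original_lmarginal hp {.w} _ _ (by decide) rfl rfl).le
        (lmarginal_copied_pair hp hp1 (by decide) _ (by decide) (by decide))
    · exact lintegral_mul_ratio_le (t := {some .w}) (v := {none, some .z}) hqm (hFm _)
        (hUm _) (hFm _) (hFd _) (hUd _) (hFd _) (by decide) (by decide) (by decide) (by decide)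
        (lmarginal_original_lmarginal hp {.w} _ _ (by decide) rfl rfl).le
        (lmarginal_copied_pair hp hp1 (by decide) _ (by decide) (by decide))
    · exact lintegral_mul_ratio_le (t := {some .y}) (v := {none, some .x, some .z}) hqm (hGm _)
        (hGm _) (hGm _) (hGd _) (hGd _) (hGd _) (by decide) (by decide) (by decide) (by decide)
        (lmarginal_lmarginal hqm {some .y} _ _ (by decide) (by decide)).le
        (lmarginal_compl_copyDensity_le hp hp1 _ _ (by decide) (by decide))
    · exact lintegral_mul_ratio_le (t := {some .x}) (v := {none, some .y}) hqm (hFm _)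
        (hUm _) (hFm _) (hFd _) (hUd _) (hFd _) (by decide) (by decide) (by decide) (by decide)
        (lmarginal_original_lmarginal hp {.x} _ _ (by decide) (by decide) rfl).le
        (lmarginal_copied_pair hp hp1 (by decide) _ (by decide) (by decide))
    · exact lintegral_mul_ratio_le (t := {some .x}) (v := {none, some .z}) hqm (hFm _)
        (hUm _) (hFm _) (hFd _) (hUd _) (hFd _) (by decide) (by decide) (by decide) (by decide)
        (lmarginal_original_lmarginal hp {.x} _ _ (by decide) (by decide) rfl).le
        (lmarginal_copied_pair hp hp1 (by decide) _ (by decide) (by decide))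
    · exact lintegral_mul_ratio_le (t := {some .y, some .z}) (v := {none, some .w, some .x}) hqm
        (hFm _) (hGm _) (hFm _) (hFd _) (hGd _) (hFd _) (by decide) (by decide) (by decide)
        (by decide) (lmarginal_original_lmarginal hp {.y, .z} _ _ (by decide) (by decide) rfl).le
        (lmarginal_compl_copyDensity_le hp hp1 _ _ (by decide) (by decide))
  have hrpos : ∀ᵐ ω ∂Q, ∀ k, r k ω ≠ 0 := by
    filter_upwards [hFpos, hUpos, hGpos] with ω hF hU hG k
    have hne : ∀ {a b t d : ℝ≥0∞}, a ≠ 0 ∧ a ≠ ∞ → b ≠ 0 ∧ b ≠ ∞ → t ≠ 0 ∧ t ≠ ∞ →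
        d ≠ 0 ∧ d ≠ ∞ → a * b / (t * d) ≠ 0 := fun ha hb ht hd =>
      ENNReal.div_ne_zero.2 ⟨mul_ne_zero ha.1 hb.1, ENNReal.mul_ne_top ht.2 hd.2⟩
    fin_cases k
    · exact hne (hG _) (hG _) (hG _) (hU _ (by decide))
    · exact hne (hG _) (hG _) (hG _) (hG _)
    · exact hne (hF _) (hU _ (by decide)) (hG _) (hF _)
    · exact hne (hF _) (hU _ (by decide)) (hG _) (hF _)
    · exact hne (hG _) (hG _) (hG _) (hG _)
    · exact hne (hF _) (hU _ (by decide)) (hG _) (hF _)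
    · exact hne (hF _) (hU _ (by decide)) (hG _) (hF _)
    · exact hne (hF _) (hG _) (hG _) (hF _)
  let lF : Finset Var → (∀ j : Option Var, α (j.getD Var.w)) → ℝ :=
    fun s ω => Real.log (F s ω).toReal
  let lU : Finset Var → (∀ j : Option Var, α (j.getD Var.w)) → ℝ :=
    fun s ω => Real.log (U s ω).toReal
  let L : (∀ j : Option Var, α (j.getD Var.w)) → ℝ :=
    - lU {.x, .y, .z} + (2 : ℝ) • lU {.x, .z} + (2 : ℝ) • lU {.x, .y} - (3 : ℝ) • lU {.x}
      + lF {.x, .z} + lF {.x, .y} + lF {.w, .z} + lF {.w, .y} - (2 : ℝ) • lF {.w, .x, .z}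
      - (2 : ℝ) • lF {.w, .x, .y} - lF {.x} - lF {.w} + (3 : ℝ) • lF {.w, .x} - lF {.y, .z}
  have hL : ∀ᵐ ω ∂Q, L ω ≤ ∑ k, Real.log (r k ω).toReal := by
    filter_upwards [hFpos, hUpos, hGpos] with ω hF hU hG
    have e0 : Real.log (G ∅ ω).toReal = Real.log (F ∅ ω).toReal + Real.log (U {.x} ω).toReal -
        Real.log (F {.w, .x} ω).toReal := by
      rw [← log_toReal_mul_div (hF _) (hU _ (by decide)) (hF _)]
      simp only [G, F, lmarginal_empty]
      rfl
    have e1 : ∀ i ∈ ({.w, .x} : Finset Var), Real.log (G {some i} ω).toReal =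
        Real.log (F {i} ω).toReal + Real.log (U {.x} ω).toReal -
        Real.log (F {.w, .x} ω).toReal := fun i hi => by
      rw [← log_toReal_mul_div (hF _) (hU _ (by decide)) (hF _)]
      simp only [G, hq, lmarginal_singleton_copyDensity hp hi]
      rfl
    have ew := e1 .w (by decide)
    have ex := e1 .x (by decide)
    rw [Fin.sum_univ_eight]
    change L ω ≤ Real.log (ENNReal.toReal (_ * _ / (_ * _))) + Real.log (ENNReal.toReal (_ * _ / (_ * _))) +
      Real.log (ENNReal.toReal (_ * _ / (_ * _))) + Real.log (ENNReal.toReal (_ * _ / (_ * _))) +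
      Real.log (ENNReal.toReal (_ * _ / (_ * _))) + Real.log (ENNReal.toReal (_ * _ / (_ * _))) +
      Real.log (ENNReal.toReal (_ * _ / (_ * _))) + Real.log (ENNReal.toReal (_ * _ / (_ * _)))
    rw [log_toReal_ratio (hG _) (hG _) (hG _) (hU _ (by decide)),
      log_toReal_ratio (hG _) (hG _) (hG _) (hG _),
      log_toReal_ratio (hF _) (hU _ (by decide)) (hG _) (hF _),
      log_toReal_ratio (hF _) (hU _ (by decide)) (hG _) (hF _),
      log_toReal_ratio (hG _) (hG _) (hG _) (hG _),
      log_toReal_ratio (hF _) (hU _ (by decide)) (hG _) (hF _),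
      log_toReal_ratio (hF _) (hU _ (by decide)) (hG _) (hF _),
      log_toReal_ratio (hF _) (hG _) (hG _) (hF _), e0, ew, ex]
    simp only [L, lF, lU, Pi.add_apply, Pi.sub_apply, Pi.neg_apply, Pi.smul_apply, smul_eq_mul]
    apply le_of_eq
    ring
  have iF : ∀ s, Integrable (lF s) Q := hFi
  have iU : ∀ s, Var.x ∈ s → Integrable (lU s) Q := hUi
  -- the integral of `L`, one term at a time
  have key : Integrable L Q ∧ ∫ ω, L ω ∂Q = - E {.x, .y, .z} + 2 * E {.x, .z} + 2 * E {.x, .y}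
      - 3 * E {.x} + E {.x, .z} + E {.x, .y} + E {.w, .z} + E {.w, .y} - 2 * E {.w, .x, .z}
      - 2 * E {.w, .x, .y} - E {.x} - E {.w} + 3 * E {.w, .x} - E {.y, .z} := by
    have add : ∀ {f g : (∀ j : Option Var, α (j.getD Var.w)) → ℝ} {a b : ℝ},
        (Integrable f Q ∧ ∫ ω, f ω ∂Q = a) → (Integrable g Q ∧ ∫ ω, g ω ∂Q = b) →
        (Integrable (f + g) Q ∧ ∫ ω, (f + g) ω ∂Q = a + b) := fun hf hg =>
      ⟨hf.1.add hg.1, by rw [integral_add' hf.1 hg.1, hf.2, hg.2]⟩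
    have sub : ∀ {f g : (∀ j : Option Var, α (j.getD Var.w)) → ℝ} {a b : ℝ},
        (Integrable f Q ∧ ∫ ω, f ω ∂Q = a) → (Integrable g Q ∧ ∫ ω, g ω ∂Q = b) →
        (Integrable (f - g) Q ∧ ∫ ω, (f - g) ω ∂Q = a - b) := fun hf hg =>
      ⟨hf.1.sub hg.1, by rw [integral_sub' hf.1 hg.1, hf.2, hg.2]⟩
    have smul : ∀ (c : ℝ) {f : (∀ j : Option Var, α (j.getD Var.w)) → ℝ} {a : ℝ},
        (Integrable f Q ∧ ∫ ω, f ω ∂Q = a) →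
        (Integrable (c • f) Q ∧ ∫ ω, (c • f) ω ∂Q = c * a) := fun c _ _ hf =>
      ⟨hf.1.smul c, by simp only [Pi.smul_apply]; rw [integral_smul, hf.2, smul_eq_mul]⟩
    have F' := fun s => And.intro (iF s) (hFE s)
    have U' := fun s hs => And.intro (iU s hs) (hUE s hs)
    have neg : Integrable (- lU {.x, .y, .z}) Q ∧ ∫ ω, (- lU {.x, .y, .z}) ω ∂Q =
        - E {.x, .y, .z} :=
      ⟨(iU _ (by decide)).neg, by rw [integral_neg', (U' _ (by decide)).2]⟩
    exact sub (add (sub (sub (sub (sub (add (add (add (add (sub (add (add neg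
      (smul 2 (U' _ (by decide)))) (smul 2 (U' _ (by decide)))) (smul 3 (U' _ (by decide))))
      (F' _)) (F' _)) (F' _)) (F' _)) (smul 2 (F' _))) (smul 2 (F' _))) (F' _)) (F' _))
      (smul 3 (F' _))) (F' _)
  have := integral_nonpos_of_le_sum_log hrm hr hrpos key.1 hL
  rw [key.2] at this
  linarith

end Main

/-! ### The Zhang–Yeung inequality for discrete and for continuous variables -/

section Density

variable {I : Type*} [Fintype I] [DecidableEq I] {α : I → Type*} [∀ i, MeasurableSpace (α i)]
  {ν : ∀ i, Measure (α i)} [∀ i, SigmaFinite (ν i)]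

/-- The density of a marginal is the original density with the other variables integrated out. -/
theorem map_restrict_withDensity {p : (∀ i, α i) → ℝ≥0∞} (hp : Measurable p) (S : Finset I)
    (ω : ∀ i, α i) :
    ((Measure.pi ν).withDensity p).map S.restrict =
      (Measure.pi fun i : S => ν i).withDensity fun y => lmarginal ν Sᶜ p (updateFinset ω S y) := by
  have hr : Measurable (S.restrict : (∀ i, α i) → ∀ i : S, α i) := Finset.measurable_restrict S
  ext A hA
  set ind : (∀ i : S, α i) → ℝ≥0∞ := A.indicator 1 with hind
  have hg : Measurable (ind ∘ S.restrict) := (measurable_one.indicator hA).comp hr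
  have hgd : DependsOn (ind ∘ S.restrict) (S : Set I) := fun a b hab => by
    simp only [comp_apply]
    congr 1
    funext i
    exact hab i i.2
  calc ((Measure.pi ν).withDensity p).map S.restrict A
      = ∫⁻ a, (p * (ind ∘ S.restrict)) a ∂Measure.pi ν := by
        rw [← lintegral_indicator_one hA, lintegral_map (measurable_one.indicator hA) hr]
        exact lintegral_withDensity_eq_lintegral_mul _ hp hg
    _ = lmarginal ν S (lmarginal ν Sᶜ p * (ind ∘ S.restrict)) ω := by
        rw [← lmarginal_mul_of_dependsOn hp hgd disjoint_compl_right,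
          lmarginal_lmarginal (hp.mul hg) S Sᶜ univ disjoint_compl_right (Finset.union_compl S),
          lmarginal_univ]
    _ = ∫⁻ y, (A.indicator fun y => lmarginal ν Sᶜ p (updateFinset ω S y)) y
          ∂Measure.pi fun i : S => ν i := by
        refine lintegral_congr fun y => ?_
        have : S.restrict (updateFinset ω S y) = y := by
          funext i
          simp [Finset.restrict, updateFinset]
        simp only [Pi.mul_apply, comp_apply, this]
        by_cases h : y ∈ A <;> simp [hind, h]
    _ = _ := by rw [lintegral_indicator hA, withDensity_apply _ hA]

theorem ae_rnDeriv_map_restrict {p : (∀ i, α i) → ℝ≥0∞} (hp : Measurable p) (S : Finset I) :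
    ∀ᵐ ω ∂(Measure.pi ν).withDensity p, (((Measure.pi ν).withDensity p).map S.restrict).rnDeriv
      (Measure.pi fun i : S => ν i) (S.restrict ω) = lmarginal ν Sᶜ p ω := by
  rcases isEmpty_or_nonempty (∀ i, α i) with h | ⟨⟨ω₀⟩⟩
  · exact Filter.Eventually.of_forall fun ω => (h.false ω).elim
  have hr : Measurable (S.restrict : (∀ i, α i) → ∀ i : S, α i) := Finset.measurable_restrict S
  have hm : Measurable fun y => lmarginal ν Sᶜ p (updateFinset ω₀ S y) :=
    (hp.lmarginal ν).comp measurable_updateFinset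
  have h1 := Measure.rnDeriv_withDensity (Measure.pi fun i : S => ν i) hm
  rw [← map_restrict_withDensity hp S ω₀] at h1
  have hac : ((Measure.pi ν).withDensity p).map S.restrict ≪ Measure.pi fun i : S => ν i := by
    rw [map_restrict_withDensity hp S ω₀]
    exact withDensity_absolutelyContinuous _ _
  filter_upwards [ae_of_ae_map hr.aemeasurable (hac.ae_le h1)] with ω hω
  rw [hω]
  refine lmarginal_congr ν p fun i hi => ?_
  have : i ∈ S := by simpa using hi
  simp [updateFinset, this]

/-- The marginal for the set of all indices lives on functions on the subtype `univ`. -/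
theorem absolutelyContinuous_of_map_restrict_univ {P : Measure (∀ i, α i)}
    (h : P.map (univ : Finset I).restrict ≪ Measure.pi fun i : (univ : Finset I) => ν i) :
    P ≪ Measure.pi ν := by
  rcases isEmpty_or_nonempty (∀ i, α i) with _ | ⟨⟨ω₀⟩⟩
  · rw [Measure.eq_zero_of_isEmpty P]
    exact Measure.AbsolutelyContinuous.zero _
  refine Measure.AbsolutelyContinuous.mk fun A hA h0 => ?_
  have hu : Measurable (updateFinset ω₀ (univ : Finset I)) := measurable_updateFinset
  rw [← lintegral_indicator_one hA, lintegral_eq_lmarginal_univ ω₀] at h0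
  have h1 : (Measure.pi fun i : (univ : Finset I) => ν i) (updateFinset ω₀ univ ⁻¹' A) = 0 := by
    rw [← lintegral_indicator_one (hu hA)]
    exact h0
  have h2 := h h1
  rw [Measure.map_apply (Finset.measurable_restrict _) (hu hA), ← Set.preimage_comp] at h2
  convert h2 using 2
  ext ω
  simp only [Set.mem_preimage, comp_apply]
  rw [show updateFinset ω₀ univ ((univ : Finset I).restrict ω) = ω by
    funext i; simp [updateFinset, Finset.restrict]]

end Density

/-- The entropy, in bits, of a distribution with respect to a reference measure. -/
noncomputable def refEntropy {Ω : Type*} [MeasurableSpace Ω] (lam μ : Measure Ω) : ℝ :=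
  - ∫ a, (μ.rnDeriv lam a).toReal * Real.logb 2 (μ.rnDeriv lam a).toReal ∂lam

/-- `μ` has a density with respect to the reference measure, and its entropy is finite. -/
def HasFiniteRefEntropy {Ω : Type*} [MeasurableSpace Ω] (lam μ : Measure Ω) : Prop :=
  μ ≪ lam ∧ Integrable
    (fun a => (μ.rnDeriv lam a).toReal * Real.logb 2 (μ.rnDeriv lam a).toReal) lam

theorem refEntropy_eq {Ω : Type*} [MeasurableSpace Ω] {lam μ : Measure Ω} [SigmaFinite lam]
    [SigmaFinite μ] (h : μ ≪ lam) :
    refEntropy lam μ = - ∫ a, Real.logb 2 (μ.rnDeriv lam a).toReal ∂μ := by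
  rw [refEntropy, integral_toReal_rnDeriv_mul h]

theorem sum_term_mul {I : Type*} [Fintype I] [DecidableEq I] (T : Finset I) (f : Finset I → ℝ) :
    ∑ S, term T S * f S = f T := by
  simp [term, Pi.single_apply]

theorem sum_zyInequality_mul (f : Finset Var → ℝ) : ∑ S, zyInequality S * f S =
    - 4 * f {.w, .y, .z} - f {.x, .y, .z} - f {.w, .x} + 3 * f {.w, .y} + 3 * f {.w, .z}
      + f {.x, .y} + f {.x, .z} + 3 * f {.y, .z} - f {.w} - 2 * f {.y} - 2 * f {.z} := by
  simp only [zyInequality, Pi.add_apply, Pi.sub_apply, Pi.smul_apply, smul_eq_mul, add_mul, sub_mul,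
    Finset.sum_add_distrib, Finset.sum_sub_distrib, mul_assoc, ← Finset.mul_sum, sum_term_mul]

/-- The Zhang–Yeung inequality for entropies with respect to a product of reference measures. -/
theorem zhangYeung_refEntropy {α : Var → Type*} [∀ i, MeasurableSpace (α i)]
    (ν : ∀ i, Measure (α i)) [∀ i, SigmaFinite (ν i)] (P : Measure (∀ i, α i))
    [IsProbabilityMeasure P]
    (h : ∀ S : Finset Var, HasFiniteRefEntropy (Measure.pi fun i : S => ν i) (P.map S.restrict)) :
    0 ≤ ∑ S : Finset Var, zyInequality S *
      refEntropy (Measure.pi fun i : S => ν i) (P.map S.restrict) := by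
  have hr : ∀ S : Finset Var, Measurable (S.restrict : (∀ i, α i) → ∀ i : S, α i) :=
    fun S => Finset.measurable_restrict S
  have hac : P ≪ Measure.pi ν := absolutelyContinuous_of_map_restrict_univ (h univ).1
  set p := P.rnDeriv (Measure.pi ν) with hp_def
  have hp : Measurable p := Measure.measurable_rnDeriv _ _
  have hP : P = (Measure.pi ν).withDensity p := (Measure.withDensity_rnDeriv_eq P _ hac).symm
  have hp1 : ∫⁻ a, p a ∂Measure.pi ν = 1 := by
    rw [← setLIntegral_univ, ← withDensity_apply _ MeasurableSet.univ, ← hP, measure_univ]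
  have hae : ∀ S : Finset Var, ∀ᵐ ω ∂P, (P.map S.restrict).rnDeriv
      (Measure.pi fun i : S => ν i) (S.restrict ω) = lmarginal ν Sᶜ p ω := fun S => by
    have := ae_rnDeriv_map_restrict (ν := ν) hp S
    rwa [← hP] at this
  have hprob : ∀ S : Finset Var, IsProbabilityMeasure (P.map S.restrict) := fun S =>
    Measure.isProbabilityMeasure_map (hr S).aemeasurable
  have hlm : ∀ S : Finset Var, Measurable fun y => Real.logb 2 ((P.map S.restrict).rnDeriv
      (Measure.pi fun i : S => ν i) y).toReal := fun S =>
    (Real.measurable_log.comp (Measure.measurable_rnDeriv _ _).ennreal_toReal).div_const _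
  have hlog : ∀ S : Finset Var, ∀ᵐ ω ∂P, Real.logb 2 ((P.map S.restrict).rnDeriv
      (Measure.pi fun i : S => ν i) (S.restrict ω)).toReal * Real.log 2 =
        Real.log (lmarginal ν Sᶜ p ω).toReal := fun S => by
    filter_upwards [hae S] with ω hω
    rw [hω, Real.logb, div_mul_cancel₀ _ (Real.log_pos one_lt_two).ne']
  have hint : ∀ S : Finset Var, Integrable (fun ω => Real.log (lmarginal ν Sᶜ p ω).toReal) P :=
    fun S => by
      have h1 := (integrable_toReal_rnDeriv_mul_iff (h S).1).1 (h S).2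
      exact ((h1.comp_measurable (hr S)).mul_const (Real.log 2)).congr (hlog S)
  set E : Finset Var → ℝ := fun s => ∫ a, Real.log (lmarginal ν s p a).toReal ∂P with hE
  have hent : ∀ S : Finset Var, refEntropy (Measure.pi fun i : S => ν i) (P.map S.restrict) =
      - (E Sᶜ / Real.log 2) := fun S => by
    rw [refEntropy_eq (h S).1, integral_map (hr S).aemeasurable (hlm S).aestronglyMeasurable, hE]
    simp only
    rw [← integral_congr_ae (hlog S), integral_mul_const, mul_div_cancel_right₀]
    exact (Real.log_pos one_lt_two).ne'
  have hZ := zhangYeung_density hp hp1 (E := E)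
    (fun s => by rw [← hP]; simpa using hint sᶜ) (fun s => by rw [← hP])
  have hsum : ∑ S : Finset Var, zyInequality S *
      refEntropy (Measure.pi fun i : S => ν i) (P.map S.restrict) =
        - (∑ S : Finset Var, zyInequality S * E Sᶜ) / Real.log 2 := by
    rw [neg_div, Finset.sum_div, ← Finset.sum_neg_distrib]
    refine Finset.sum_congr rfl fun S _ => ?_
    rw [hent]
    ring
  rw [hsum, sum_zyInequality_mul fun S => E Sᶜ]
  simp only [show ({.w, .y, .z} : Finset Var)ᶜ = {.x} by decide,
    show ({.x, .y, .z} : Finset Var)ᶜ = {.w} by decide,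
    show ({.w, .x} : Finset Var)ᶜ = {.y, .z} by decide,
    show ({.w, .y} : Finset Var)ᶜ = {.x, .z} by decide,
    show ({.w, .z} : Finset Var)ᶜ = {.x, .y} by decide,
    show ({.x, .y} : Finset Var)ᶜ = {.w, .z} by decide,
    show ({.x, .z} : Finset Var)ᶜ = {.w, .y} by decide,
    show ({.y, .z} : Finset Var)ᶜ = {.w, .x} by decide,
    show ({.w} : Finset Var)ᶜ = {.x, .y, .z} by decide,
    show ({.y} : Finset Var)ᶜ = {.w, .x, .z} by decide,
    show ({.z} : Finset Var)ᶜ = {.w, .x, .y} by decide]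
  exact div_nonneg (by linarith) (Real.log_pos one_lt_two).le

/-- The Zhang–Yeung inequality holds for differential entropy. -/
theorem isDiffEntropicInequality_zyInequality : IsDiffEntropicInequality zyInequality :=
  fun _ P _ h => zhangYeung_refEntropy (fun _ => volume) P h

theorem count_withDensity_singleton {Ω : Type*} [MeasurableSpace Ω] [Countable Ω]
    [MeasurableSingletonClass Ω] (μ : Measure Ω) :
    Measure.count.withDensity (fun a => μ {a}) = μ := by
  refine Measure.ext_of_singleton fun a => ?_
  rw [withDensity_apply _ (measurableSet_singleton a), lintegral_singleton]
  simp

theorem rnDeriv_count {Ω : Type*} [MeasurableSpace Ω] [Countable Ω]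
    [MeasurableSingletonClass Ω] (μ : Measure Ω) (a : Ω) : μ.rnDeriv Measure.count a = μ {a} := by
  have h := Measure.rnDeriv_withDensity (Measure.count : Measure Ω) (f := fun a => μ {a})
    (measurable_of_countable _)
  rw [count_withDensity_singleton, Filter.EventuallyEq, ae_iff] at h
  by_contra hne
  have := Measure.count_eq_zero_iff.1 h
  exact Set.notMem_empty a (this ▸ hne)

theorem hasFiniteRefEntropy_count {Ω : Type*} [MeasurableSpace Ω] [Countable Ω]
    [MeasurableSingletonClass Ω] {μ : Measure Ω} (h : HasFiniteShannonEntropy μ) :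
    HasFiniteRefEntropy Measure.count μ := by
  refine ⟨?_, ?_⟩
  · rw [← count_withDensity_singleton μ]
    exact withDensity_absolutelyContinuous _ _
  · simp only [rnDeriv_count]
    exact integrable_count_iff.2 (summable_norm_iff.2 h)

theorem refEntropy_count {Ω : Type*} [MeasurableSpace Ω] [Countable Ω]
    [MeasurableSingletonClass Ω] {μ : Measure Ω} (h : HasFiniteShannonEntropy μ) :
    refEntropy Measure.count μ = shannonEntropy μ := by
  have h2 := (hasFiniteRefEntropy_count h).2
  rw [refEntropy, shannonEntropy, integral_countable h2]
  simp only [rnDeriv_count]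
  simp [Measure.real]

theorem pi_count_eq_count {ι : Type*} [Fintype ι] {α : ι → Type*} [∀ i, MeasurableSpace (α i)]
    [∀ i, Countable (α i)] [∀ i, MeasurableSingletonClass (α i)] :
    Measure.pi (fun i => (Measure.count : Measure (α i))) = Measure.count := by
  refine Measure.ext_of_singleton fun a => ?_
  rw [Measure.pi_singleton]
  simp

/-- The Zhang–Yeung inequality holds for Shannon entropy. -/
theorem isEntropicInequality_zyInequality : IsEntropicInequality zyInequality := by
  intro α _ _ _ P _ h
  have hpi := fun S : Finset Var => pi_count_eq_count (α := fun i : S => α i)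
  have h1 := zhangYeung_refEntropy (fun i => (Measure.count : Measure (α i))) P fun S => by
    rw [hpi]
    exact hasFiniteRefEntropy_count (h S)
  simp only [hpi] at h1
  simpa only [fun S => refEntropy_count (h S)] using h1

/-! ### The polymatroid that extends `fZY` -/

/-- The extension of `fZY` to all sets of variables, with values in `ℕ`. -/
def rankZY (S : Finset Var) : ℕ :=
  if S = ∅ then 0
  else if S = {.w, .x} then 4
  else if S.card = 1 then 2
  else if S.card = 2 then 3
  else 4

theorem rankZY_mono : ∀ S T, S ⊆ T → rankZY S ≤ rankZY T := by decide

theorem rankZY_submod : ∀ S T, rankZY (S ∩ T) + rankZY (S ∪ T) ≤ rankZY S + rankZY T := by decide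

theorem fZY_eq (S : zyScenario.faces) : fZY S = rankZY S.1 := by
  unfold fZY rankZY
  push_cast
  rfl

theorem isPolymatroid_rankZY : IsPolymatroid fun S => (rankZY S : ℝ) where
  empty := by simp [rankZY]
  nonneg S := Nat.cast_nonneg _
  mono S T h := Nat.cast_le.2 (rankZY_mono S T h)
  submod S T := by exact_mod_cast rankZY_submod S T

theorem isSubmodular_rankZY : IsSubmodular fun S => (rankZY S : ℝ) where
  empty := isPolymatroid_rankZY.empty
  submod := isPolymatroid_rankZY.submod

theorem isPartialPolymatroid_fZY : IsPartialPolymatroid fZY where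
  empty h := by simp [fZY]
  nonneg S := by rw [fZY_eq]; exact isPolymatroid_rankZY.nonneg _
  mono S T h := by rw [fZY_eq, fZY_eq]; exact isPolymatroid_rankZY.mono _ _ h
  submod S T h := by simp only [fZY_eq]; exact isPolymatroid_rankZY.submod _ _

theorem supportedOn_zyInequality : SupportedOn zyScenario zyInequality := by
  intro S hS
  have h : ∀ T ∈ zyScenario.faces, term T S = 0 := fun T hT => by
    rw [term, Pi.single_apply, if_neg]
    rintro rfl
    exact hS hT
  simp only [zyInequality, Pi.add_apply, Pi.sub_apply, Pi.smul_apply]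
  rw [h {.w, .y, .z} (by decide), h {.x, .y, .z} (by decide), h {.w, .x} (by decide),
    h {.w, .y} (by decide), h {.w, .z} (by decide), h {.x, .y} (by decide), h {.x, .z} (by decide),
    h {.y, .z} (by decide), h {.w} (by decide), h {.y} (by decide), h {.z} (by decide)]
  simp

theorem evalOn_eq_sum {I : Type*} [Fintype I] [DecidableEq I] {M : MarginalScenario I}
    {c : Finset I → ℝ} (hc : SupportedOn M c) (h : Finset I → ℝ) :
    evalOn c (fun S : M.faces => h S.1) = ∑ S, c S * h S := by
  rw [evalOn, Finset.sum_coe_sort M.faces fun S => c S * h S]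
  exact Finset.sum_subset (subset_univ _) fun S _ hS => by rw [hc S hS, zero_mul]

theorem sum_zyInequality_rankZY : ∑ S, zyInequality S * (rankZY S : ℝ) = -1 := by
  rw [sum_zyInequality_mul]
  have h : rankZY {.w, .y, .z} = 4 ∧ rankZY {.x, .y, .z} = 4 ∧ rankZY {.w, .x} = 4 ∧
    rankZY {.w, .y} = 3 ∧ rankZY {.w, .z} = 3 ∧ rankZY {.x, .y} = 3 ∧ rankZY {.x, .z} = 3 ∧
    rankZY {.y, .z} = 3 ∧ rankZY {.w} = 2 ∧ rankZY {.y} = 2 ∧ rankZY {.z} = 2 := by decide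
  obtain ⟨h1, h2, h3, h4, h5, h6, h7, h8, h9, h10, h11⟩ := h
  rw [h1, h2, h3, h4, h5, h6, h7, h8, h9, h10, h11]
  norm_num

theorem evalOn_fZY : evalOn zyInequality fZY = -1 := by
  rw [← sum_zyInequality_rankZY, ← evalOn_eq_sum supportedOn_zyInequality]
  exact congrArg _ (funext fZY_eq)

/-! ### Shannon-type inequalities -/

theorem sum_mul_nonneg_of_mem_hull {I : Type*} [Fintype I] [DecidableEq I]
    {X : Set (Finset I → ℝ)} {f : Finset I → ℝ} (hX : ∀ c ∈ X, 0 ≤ ∑ S, c S * f S)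
    {c : Finset I → ℝ} (hc : c ∈ PointedCone.hull ℝ X) : 0 ≤ ∑ S, c S * f S := by
  induction hc using Submodule.span_induction with
  | mem c hc => exact hX c hc
  | zero => simp
  | add a b _ _ ha hb =>
    simp only [Pi.add_apply, add_mul, Finset.sum_add_distrib]
    exact add_nonneg ha hb
  | smul r a _ ha =>
    have : ∑ S, (r • a) S * f S = (r : ℝ) * ∑ S, a S * f S := by
      rw [Finset.mul_sum]
      refine Finset.sum_congr rfl fun S _ => ?_
      rw [← mul_assoc]
      rfl
    rw [this]
    exact mul_nonneg r.2 ha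

theorem sum_normalization_nonneg {I : Type*} [Fintype I] [DecidableEq I] {f : Finset I → ℝ}
    (hf : f ∅ = 0) {c : Finset I → ℝ} (hc : c ∈ normalizationInequalities I) :
    0 ≤ ∑ S, c S * f S := by
  rcases hc with rfl | rfl
  · rw [sum_term_mul, hf]
  · simp only [Pi.neg_apply, neg_mul, Finset.sum_neg_distrib, sum_term_mul, hf, neg_zero, le_refl]

theorem sum_submodularity_nonneg {I : Type*} [Fintype I] [DecidableEq I] {f : Finset I → ℝ}
    (hf : ∀ S T, f (S ∩ T) + f (S ∪ T) ≤ f S + f T) {c : Finset I → ℝ}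
    (hc : c ∈ submodularityInequalities I) : 0 ≤ ∑ S, c S * f S := by
  obtain ⟨S, T, rfl⟩ := hc
  simp only [Pi.add_apply, Pi.sub_apply, add_mul, sub_mul, Finset.sum_add_distrib,
    Finset.sum_sub_distrib, sum_term_mul]
  linarith [hf S T]

theorem IsShannonType.sum_nonneg {I : Type*} [Fintype I] [DecidableEq I] {c f : Finset I → ℝ}
    (hc : IsShannonType c) (hf : IsPolymatroid f) : 0 ≤ ∑ S, c S * f S := by
  refine sum_mul_nonneg_of_mem_hull (fun c hc => ?_) hc
  rcases hc with ((hc | ⟨S, rfl⟩) | ⟨S, T, hST, rfl⟩) | hc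
  · exact sum_normalization_nonneg hf.empty hc
  · rw [sum_term_mul]
    exact hf.nonneg S
  · simp only [Pi.sub_apply, sub_mul, Finset.sum_sub_distrib, sum_term_mul]
    exact sub_nonneg.2 (hf.mono S T hST)
  · exact sum_submodularity_nonneg hf.submod hc

theorem IsDiffShannonType.sum_nonneg {I : Type*} [Fintype I] [DecidableEq I] {c f : Finset I → ℝ}
    (hc : IsDiffShannonType c) (hf : IsSubmodular f) : 0 ≤ ∑ S, c S * f S := by
  refine sum_mul_nonneg_of_mem_hull (fun c hc => ?_) hc
  rcases hc with hc | hc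
  · exact sum_normalization_nonneg hf.empty hc
  · exact sum_submodularity_nonneg hf.submod hc

theorem not_isShannonType_zyInequality : ¬ IsShannonType zyInequality := fun h => by
  have := h.sum_nonneg isPolymatroid_rankZY
  rw [sum_zyInequality_rankZY] at this
  linarith

theorem not_isDiffShannonType_zyInequality : ¬ IsDiffShannonType zyInequality := fun h => by
  have := h.sum_nonneg isSubmodular_rankZY
  rw [sum_zyInequality_rankZY] at this
  linarith

/-! ### The entropies of the discrete model -/

/-- A function of uniformly distributed data all of whose fibres contain a fraction of `2 ^ (-k)`
of the data has an entropy of `k` bits. -/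
theorem shannonEntropy_map_uniform {Ω β : Type*} [Fintype Ω] [Nonempty Ω] [Fintype β]
    [DecidableEq β] [MeasurableSpace β] [MeasurableSingletonClass β] (f : Ω → β) (k : ℕ)
    (hf : ∀ ω, (univ.filter fun ω' => f ω = f ω').card * 2 ^ k = Fintype.card Ω) :
    shannonEntropy ((PMF.uniformOfFintype Ω).map f).toMeasure = k := by
  set p := (PMF.uniformOfFintype Ω).map f with hp
  have hcard : (Fintype.card Ω : ℝ) ≠ 0 := by exact_mod_cast Fintype.card_ne_zero
  have hval : ∀ b, p.toMeasure.real {b} =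
      (univ.filter fun ω => b = f ω).card / (Fintype.card Ω : ℝ) := fun b => by
    rw [Measure.real, PMF.toMeasure_apply_singleton p b (measurableSet_singleton b), hp,
      PMF.map_apply, tsum_fintype]
    simp only [PMF.uniformOfFintype_apply]
    rw [← Finset.sum_filter, Finset.sum_const, nsmul_eq_mul, ENNReal.toReal_mul, ENNReal.toReal_inv]
    simp [div_eq_mul_inv]
  have hterm : ∀ b, p.toMeasure.real {b} * Real.logb 2 (p.toMeasure.real {b}) =
      - (k * p.toMeasure.real {b}) := fun b => by
    by_cases hb : ∃ ω, f ω = b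
    · obtain ⟨ω, rfl⟩ := hb
      have h1 : p.toMeasure.real {f ω} = ((2 : ℝ) ^ k)⁻¹ := by
        have h2 : ((univ.filter fun ω' => f ω = f ω').card : ℝ) * 2 ^ k = Fintype.card Ω := by
          exact_mod_cast hf ω
        rw [hval, div_eq_iff hcard, ← h2]
        field_simp
      have h3 : Real.logb 2 ((2 : ℝ) ^ k)⁻¹ = - k := by
        rw [Real.logb_inv, Real.logb_pow, Real.logb_self_eq_one one_lt_two, mul_one]
      rw [h1, h3]
      ring
    · have : p.toMeasure.real {b} = 0 := by
        rw [hval, Finset.filter_false_of_mem fun ω _ h => hb ⟨ω, h.symm⟩]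
        simp
      rw [this]
      simp
  have hsum : ∑ b, p.toMeasure.real {b} = 1 := by
    rw [sum_measureReal_singleton, Finset.coe_univ, probReal_univ]
  rw [shannonEntropy, tsum_fintype]
  simp only [hterm]
  rw [Finset.sum_neg_distrib, ← Finset.mul_sum, hsum]
  simp

/-- The fibres of `readOut`: the bits that are read are fixed, the others are free. -/
theorem card_fiber_readOut (S : Finset Var) (ω : Bits) :
    (univ.filter fun ω' => readOut S ω = readOut S ω').card =
      (∏ i : Var, if i ∈ S then 1 else 2) * ((if ∃ i ∈ S, ¬ (i = .x ∧ .w ∈ S) then 1 else 2) *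
        (if Var.x ∈ S ∧ Var.w ∈ S then 1 else 2)) := by
  have h : (univ.filter fun ω' => readOut S ω = readOut S ω') =
      (Fintype.piFinset fun i : Var => if i ∈ S then {ω.1 i} else univ) ×ˢ
        ((if ∃ i ∈ S, ¬ (i = .x ∧ .w ∈ S) then {ω.2.1} else univ) ×ˢ
          (if Var.x ∈ S ∧ Var.w ∈ S then {ω.2.2} else univ)) := by
    ext ω'
    simp only [mem_filter, mem_univ, true_and, mem_product, Fintype.mem_piFinset]
    constructor
    · intro h
      have h' : ∀ i (hi : i ∈ S), ω.1 i = ω'.1 i ∧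
          (if i = .x ∧ .w ∈ S then ω.2.2 else ω.2.1) =
            if i = .x ∧ .w ∈ S then ω'.2.2 else ω'.2.1 := fun i hi => by
        have := congrFun h ⟨i, hi⟩
        simpa [readOut] using this
      refine ⟨fun i => ?_, ?_, ?_⟩
      · split_ifs with hi
        · simp [(h' i hi).1]
        · simp
      · split_ifs with hi
        · obtain ⟨i, hi, hn⟩ := hi
          have := (h' i hi).2
          rw [if_neg hn, if_neg hn] at this
          simp [this]
        · simp
      · split_ifs with hi
        · have := (h' .x hi.1).2
          rw [if_pos ⟨rfl, hi.2⟩, if_pos ⟨rfl, hi.2⟩] at this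
          simp [this]
        · simp
    · rintro ⟨h1, h2, h3⟩
      funext i
      have hi := i.2
      have e1 := h1 i.1
      rw [if_pos hi, mem_singleton] at e1
      simp only [readOut, Prod.mk.injEq]
      refine ⟨e1.symm, ?_⟩
      split_ifs with hx
      · rw [if_pos ⟨hx.1 ▸ hi, hx.2⟩, mem_singleton] at h3
        exact h3.symm
      · rw [if_pos ⟨i.1, hi, hx⟩, mem_singleton] at h2
        exact h2.symm
  rw [h, card_product, card_product, Fintype.card_piFinset]
  congr 1
  · refine Finset.prod_congr rfl fun i _ => ?_
    split_ifs <;> simp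
  · congr 1 <;> split_ifs <;> simp

theorem fiber_mul_rankZY : ∀ S ∈ zyScenario.faces,
    (∏ i : Var, if i ∈ S then 1 else 2) * ((if ∃ i ∈ S, ¬ (i = .x ∧ .w ∈ S) then 1 else 2) *
        (if Var.x ∈ S ∧ Var.w ∈ S then 1 else 2)) * 2 ^ rankZY S = 64 := by
  decide

theorem shannonEntropy_zyModel (S : zyScenario.faces) :
    shannonEntropy (zyModel.dist S) = fZY S := by
  classical
  rw [fZY_eq]
  refine shannonEntropy_map_uniform (readOut S.1) (rankZY S.1) fun ω => ?_
  have h := card_fiber_readOut S.1 ω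
  have h64 : Fintype.card Bits = 64 := by simp [Bits]; rfl
  rw [h64, ← fiber_mul_rankZY S.1 S.2, ← h]

theorem zyModel_isContextual : zyModel.IsContextual := by
  rintro ⟨P, hP, h⟩
  have h1 := isEntropicInequality_zyInequality (fun _ => Bool × Bool) P
    fun S => (hasSum_fintype _).summable
  rw [← evalOn_eq_sum supportedOn_zyInequality] at h1
  have h2 : (fun S : zyScenario.faces => shannonEntropy (P.map S.1.restrict)) = fZY :=
    funext fun S => by rw [h S, shannonEntropy_zyModel]
  rw [h2, evalOn_fZY] at h1
  linarith

/-! ### The continuous model -/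

/-- The half-open unit cube, here an interval, as a subset of `ℝ ^ 1`. -/
def unitCube : Set (Fin 1 → ℝ) := Set.univ.pi fun _ => Set.Ico 0 1

/-- A pair of bits as one of the numbers `0`, `1`, `2`, `3`. -/
def encode (a : Bool × Bool) : Fin 1 → ℝ :=
  fun _ => (if a.1 then 2 else 0) + (if a.2 then 1 else 0)

/-- The pair of bits that is encoded by the integer part of a number in `[0, 4)`. -/
noncomputable def decode (v : Fin 1 → ℝ) : Bool × Bool :=
  (decide (2 ≤ v 0), decide ((1 ≤ v 0 ∧ v 0 < 2) ∨ 3 ≤ v 0))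

theorem measurableSet_unitCube : MeasurableSet unitCube :=
  MeasurableSet.univ_pi fun _ => measurableSet_Ico

theorem decode_encode_add (a : Bool × Bool) {u : Fin 1 → ℝ} (hu : u ∈ unitCube) :
    decode (encode a + u) = a := by
  have h := hu 0 (Set.mem_univ 0)
  obtain ⟨h0, h1⟩ := h
  obtain ⟨a, b⟩ := a
  cases a <;> cases b <;> simp [decode, encode] <;> grind

theorem measurable_decode : Measurable decode := by
  have h0 : Measurable fun v : Fin 1 → ℝ => v 0 := measurable_pi_apply 0
  have hp : ∀ {q : (Fin 1 → ℝ) → Prop} [DecidablePred q], MeasurableSet {v | q v} →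
      Measurable fun v => decide (q v) := fun h => measurable_to_bool (by simpa [Set.preimage] using h)
  exact (hp (measurableSet_le measurable_const h0)).prodMk
    (hp (((measurableSet_le measurable_const h0).inter
      (measurableSet_lt h0 measurable_const)).union (measurableSet_le measurable_const h0)))

/-- The uniform distribution on the unit cube. -/
noncomputable def noise : Measure (Fin 1 → ℝ) := volume.restrict unitCube

instance : IsProbabilityMeasure noise := ⟨by
  rw [noise, Measure.restrict_apply_univ, unitCube, Real.volume_pi_Ico]
  simp⟩

theorem ae_noise : ∀ᵐ u ∂noise, u ∈ unitCube := ae_restrict_mem measurableSet_unitCube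

/-- The points of the unit cube translated to `encode a`. -/
def cell (a : Bool × Bool) : Set (Fin 1 → ℝ) := (fun v => - encode a + v) ⁻¹' unitCube

theorem measurableSet_cell (a : Bool × Bool) : MeasurableSet (cell a) :=
  (measurable_const_add _) measurableSet_unitCube

theorem map_add_noise (a : Bool × Bool) :
    noise.map (fun v => encode a + v) = volume.restrict (cell a) := by
  have h := Measure.restrict_map (μ := (volume : Measure (Fin 1 → ℝ)))
    (measurable_const_add (encode a)) (measurableSet_cell a)
  rw [map_add_left_eq_self] at h
  rw [h, noise]
  congr 2
  ext v
  simp [cell]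

/-- Decoding the point recovers the number of its cell. -/
theorem decode_of_mem_cell {a : Bool × Bool} {v : Fin 1 → ℝ} (hv : v ∈ cell a) : decode v = a := by
  have := decode_encode_add a (u := - encode a + v) hv
  rwa [add_neg_cancel_left] at this

/-- The variables of the continuous model: a number in `{0, 1, 2, 3}`, which encodes the two bits
of the discrete model, plus noise. -/
noncomputable def blur (S : Finset Var) (b : ((i : S) → Bool × Bool) × (Var → Fin 1 → ℝ)) :
    (i : S) → Fin 1 → ℝ := fun i => encode (b.1 i) + b.2 i

theorem measurable_blur (S : Finset Var) : Measurable (blur S) := by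
  refine measurable_pi_iff.2 fun i => ?_
  exact ((measurable_of_finite encode).comp ((measurable_pi_apply i).comp measurable_fst)).add
    ((measurable_pi_apply i.1).comp measurable_snd)

/-- The discrete variables together with independent noise. -/
noncomputable def noisyLaw (S : Finset Var) :
    Measure (((i : S) → Bool × Bool) × (Var → Fin 1 → ℝ)) :=
  (bitDist S).prod (Measure.pi fun _ => noise)

instance (S : Finset Var) : IsProbabilityMeasure (bitDist S) := by
  unfold bitDist
  infer_instance

instance (S : Finset Var) : IsProbabilityMeasure (noisyLaw S) := by
  unfold noisyLaw
  infer_instance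

/-- The distributions of the continuous model. -/
noncomputable def contDist (S : Finset Var) : Measure ((i : S) → Fin 1 → ℝ) :=
  (noisyLaw S).map (blur S)

instance (S : Finset Var) : IsProbabilityMeasure (contDist S) :=
  Measure.isProbabilityMeasure_map (measurable_blur S).aemeasurable

theorem contDist_compatible (S T : zyScenario.faces) (h : T.1 ⊆ S.1) :
    (contDist S.1).map (Finset.restrict₂ (π := fun _ => Fin 1 → ℝ) h) = contDist T.1 := by
  have hm := Finset.measurable_restrict₂ (X := fun _ : Var => Bool × Bool) h
  have hm' := Finset.measurable_restrict₂ (X := fun _ : Var => Fin 1 → ℝ) h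
  have h1 : noisyLaw T.1 = (noisyLaw S.1).map
      (Prod.map (Finset.restrict₂ (π := fun _ : Var => Bool × Bool) h) id) := by
    rw [noisyLaw, noisyLaw, ← Measure.map_prod_map _ _ hm measurable_id,
      bitDist_compatible S T h, Measure.map_id]
  rw [contDist, contDist, h1, Measure.map_map hm' (measurable_blur _),
    Measure.map_map (measurable_blur _) (hm.prodMap measurable_id)]
  rfl

/-- The continuous marginal model. -/
noncomputable def contModel : MarginalModel zyScenario (fun _ => Fin 1 → ℝ) where
  dist S := contDist S.1
  isProbabilityMeasure _ := inferInstance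
  compatible := contDist_compatible

theorem ae_noisyLaw (S : Finset Var) : ∀ᵐ b ∂noisyLaw S, ∀ i, b.2 i ∈ unitCube := by
  have h1 : ∀ᵐ u ∂Measure.pi fun _ : Var => noise, ∀ i, u i ∈ unitCube :=
    ae_all_iff.2 fun i => (Measure.quasiMeasurePreserving_eval (fun _ => noise) i).ae ae_noise
  exact Measure.quasiMeasurePreserving_snd.ae h1

/-- The density of the continuous model is constant on each product of cells. -/
noncomputable def contDensity (S : Finset Var) (y : (i : S) → Fin 1 → ℝ) : ℝ≥0∞ :=
  ∑ a : (i : S) → Bool × Bool, bitDist S {a} * (Set.univ.pi fun i => cell (a i)).indicator 1 y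

theorem measurableSet_pi_cell {S : Finset Var} (a : (i : S) → Bool × Bool) :
    MeasurableSet (Set.univ.pi fun i => cell (a i)) :=
  MeasurableSet.univ_pi fun i => measurableSet_cell (a i)

theorem measurable_contDensity (S : Finset Var) : Measurable (contDensity S) :=
  Finset.measurable_sum _ fun a _ =>
    (measurable_one.indicator (measurableSet_pi_cell a)).const_mul _

theorem map_blur_noise (S : Finset Var) (a : (i : S) → Bool × Bool) :
    (Measure.pi fun _ : Var => noise).map (fun u => blur S (a, u)) =
      volume.restrict (Set.univ.pi fun i => cell (a i)) := by
  have h1 : (Measure.pi fun _ : Var => noise).map (S.restrict) = Measure.pi fun _ : S => noise := by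
    rw [← Measure.infinitePi_eq_pi]
    exact Measure.infinitePi_map_restrict _
  have h2 : ∀ i : S, Measurable fun v => encode (a i) + v := fun i => measurable_const_add _
  have h3 : (fun u => blur S (a, u)) =
      (fun (u : (i : S) → Fin 1 → ℝ) i => encode (a i) + u i) ∘ S.restrict := rfl
  have h4 : ∀ i : S, SigmaFinite (noise.map fun v => encode (a i) + v) := fun i => by
    have := Measure.isProbabilityMeasure_map (μ := noise) (h2 i).aemeasurable
    infer_instance
  have h5 : Measurable fun (u : (i : S) → Fin 1 → ℝ) i => encode (a i) + u i :=
    measurable_pi_iff.2 fun i => (h2 i).comp (measurable_pi_apply i)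
  rw [h3, ← Measure.map_map h5 (Finset.measurable_restrict S), h1, Measure.pi_map_pi fun i => (h2 i).aemeasurable]
  simp only [map_add_noise]
  exact (Measure.restrict_pi_pi (fun _ => volume) fun i : S => cell (a i)).symm

theorem contDist_eq_withDensity (S : Finset Var) :
    contDist S = volume.withDensity (contDensity S) := by
  ext A hA
  rw [contDist, Measure.map_apply (measurable_blur S) hA, noisyLaw,
    Measure.prod_apply (measurable_blur S hA), lintegral_fintype, withDensity_apply _ hA]
  unfold contDensity
  rw [lintegral_finsetSum _ fun a _ =>
    (measurable_one.indicator (measurableSet_pi_cell a)).const_mul _]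
  refine Finset.sum_congr rfl fun a _ => ?_
  rw [lintegral_const_mul _ (measurable_one.indicator (measurableSet_pi_cell a)),
    lintegral_indicator_one (measurableSet_pi_cell a), mul_comm,
    Measure.restrict_apply (measurableSet_pi_cell a), Set.inter_comm, ← Measure.restrict_apply hA,
    ← map_blur_noise]
  have hm : Measurable fun u => blur S (a, u) := (measurable_blur S).comp measurable_prodMk_left
  rw [Measure.map_apply hm hA]
  rfl

theorem decode_blur {S : Finset Var} {b : ((i : S) → Bool × Bool) × (Var → Fin 1 → ℝ)}
    (hb : ∀ i, b.2 i ∈ unitCube) : (fun i => decode (blur S b i)) = b.1 :=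
  funext fun i => decode_encode_add (b.1 i) (hb i)

theorem contDensity_blur {S : Finset Var} {b : ((i : S) → Bool × Bool) × (Var → Fin 1 → ℝ)}
    (hb : ∀ i, b.2 i ∈ unitCube) : contDensity S (blur S b) = bitDist S {b.1} := by
  rw [contDensity, Finset.sum_eq_single b.1]
  · rw [Set.indicator_of_mem, Pi.one_apply, mul_one]
    intro i _
    simpa [cell, blur] using hb i
  · intro a _ hne
    rw [Set.indicator_of_notMem, mul_zero]
    intro hmem
    refine hne ?_
    rw [← decode_blur hb]
    exact funext fun i => (decode_of_mem_cell (hmem i (Set.mem_univ i))).symm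
  · simp

theorem ae_rnDeriv_contDist (S : Finset Var) : ∀ᵐ b ∂noisyLaw S,
    Real.logb 2 ((contDist S).rnDeriv volume (blur S b)).toReal =
      Real.logb 2 ((bitDist S).real {b.1}) := by
  have h1 := Measure.rnDeriv_withDensity (volume : Measure ((i : S) → Fin 1 → ℝ))
    (measurable_contDensity S)
  rw [← contDist_eq_withDensity] at h1
  have hac : contDist S ≪ volume := by
    rw [contDist_eq_withDensity]
    exact withDensity_absolutelyContinuous _ _
  filter_upwards [ae_of_ae_map (measurable_blur S).aemeasurable (hac.ae_le h1), ae_noisyLaw S]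
    with b hb1 hb2
  rw [hb1, contDensity_blur hb2]
  rfl

theorem hasFiniteDiffEntropy_contDist (S : Finset Var) : HasFiniteDiffEntropy (contDist S) := by
  have hac : contDist S ≪ volume := by
    rw [contDist_eq_withDensity]
    exact withDensity_absolutelyContinuous _ _
  refine ⟨hac, (integrable_toReal_rnDeriv_mul_iff hac).2 ?_⟩
  have hm : Measurable fun y => Real.logb 2 ((contDist S).rnDeriv volume y).toReal :=
    (Real.measurable_log.comp (Measure.measurable_rnDeriv _ _).ennreal_toReal).div_const _
  refine (integrable_map_measure hm.aestronglyMeasurable (measurable_blur S).aemeasurable).2 ?_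
  have hfin : Integrable (fun a => Real.logb 2 ((bitDist S).real {a})) (bitDist S) :=
    Integrable.of_finite
  exact (hfin.comp_fst _).congr ((ae_rnDeriv_contDist S).mono fun _ h => h.symm)

/-- The noise does not contribute to the entropy. -/
theorem diffEntropy_contDist (S : Finset Var) :
    diffEntropy (contDist S) = shannonEntropy (bitDist S) := by
  have hm : Measurable fun y => Real.logb 2 ((contDist S).rnDeriv volume y).toReal :=
    (Real.measurable_log.comp (Measure.measurable_rnDeriv _ _).ennreal_toReal).div_const _
  have hfin : Integrable (fun a => Real.logb 2 ((bitDist S).real {a})) (bitDist S) :=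
    Integrable.of_finite
  change refEntropy volume (contDist S) = _
  rw [refEntropy_eq (hasFiniteDiffEntropy_contDist S).1, shannonEntropy]
  congr 1
  calc ∫ y, Real.logb 2 ((contDist S).rnDeriv volume y).toReal ∂contDist S
      = ∫ b, Real.logb 2 ((contDist S).rnDeriv volume (blur S b)).toReal ∂noisyLaw S :=
        integral_map (measurable_blur S).aemeasurable hm.aestronglyMeasurable
    _ = ∫ b, Real.logb 2 ((bitDist S).real {b.1}) ∂noisyLaw S :=
        integral_congr_ae (ae_rnDeriv_contDist S)
    _ = ∫ a, Real.logb 2 ((bitDist S).real {a}) ∂bitDist S := by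
        rw [noisyLaw, integral_fun_fst fun a => Real.logb 2 ((bitDist S).real {a})]
        simp
    _ = _ := integral_countable hfin

theorem diffEntropy_contModel (S : zyScenario.faces) :
    diffEntropy (contModel.dist S) = fZY S :=
  (diffEntropy_contDist S.1).trans (shannonEntropy_zyModel S)

theorem map_decode_contDist (S : Finset Var) :
    (contDist S).map (fun y i => decode (y i)) = bitDist S := by
  have hd : Measurable fun (y : (i : S) → Fin 1 → ℝ) i => decode (y i) :=
    measurable_pi_iff.2 fun i => measurable_decode.comp (measurable_pi_apply i)
  rw [contDist, Measure.map_map hd (measurable_blur S)]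
  have : (noisyLaw S).map ((fun (y : (i : S) → Fin 1 → ℝ) i => decode (y i)) ∘ blur S) =
      (noisyLaw S).map Prod.fst :=
    Measure.map_congr ((ae_noisyLaw S).mono fun b hb => decode_blur hb)
  rw [this, noisyLaw, Measure.map_fst_prod]
  simp

/-- Decoding a joint distribution for the continuous model gives one for the discrete model, so
that no assumption on the densities of the joint distribution is needed. -/
theorem contModel_isContextual : contModel.IsContextual := by
  rintro ⟨P, hP, h⟩
  have hd : Measurable fun (ω : Var → Fin 1 → ℝ) i => decode (ω i) :=
    measurable_pi_iff.2 fun i => measurable_decode.comp (measurable_pi_apply i)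
  refine zyModel_isContextual ⟨P.map fun ω i => decode (ω i),
    Measure.isProbabilityMeasure_map hd.aemeasurable, fun S => ?_⟩
  have hd' : Measurable fun (y : (i : S.1) → Fin 1 → ℝ) i => decode (y i) :=
    measurable_pi_iff.2 fun i => measurable_decode.comp (measurable_pi_apply i)
  have h1 := map_decode_contDist S.1
  have h2 : P.map S.1.restrict = contDist S.1 := h S
  rw [← h2, Measure.map_map hd' (Finset.measurable_restrict _)] at h1
  rw [Measure.map_map (Finset.measurable_restrict _) hd]
  exact h1

end EntropicMarginal
open EntropicMarginal in
theorem corollary7p2 :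
    -- `f^ZY` is a partial polymatroid
    IsPartialPolymatroid fZY ∧
    -- it consists of the entropies of the explicit marginal model
    (∀ S, shannonEntropy (zyModel.dist S) = fZY S) ∧
    -- the Zhang–Yeung inequality is an entropic inequality on the scenario, not of Shannon type
    SupportedOn zyScenario zyInequality ∧
    IsEntropicInequality zyInequality ∧
    ¬ IsShannonType zyInequality ∧
    -- it detects that the model is contextual
    evalOn zyInequality (fun S => shannonEntropy (zyModel.dist S)) < 0 ∧
    zyModel.IsContextual ∧
    -- `f^ZY` extends to a polymatroid, and no Shannon-type inequality detects the contextuality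
    (∃ g : Finset Var → ℝ, IsPolymatroid g ∧ ∀ S : zyScenario.faces, g S.1 = fZY S) ∧
    (∀ c : Finset Var → ℝ, IsShannonType c → SupportedOn zyScenario c →
      0 ≤ evalOn c (fun S => shannonEntropy (zyModel.dist S))) ∧
    -- the same for differential entropy
    IsDiffEntropicInequality zyInequality ∧
    ¬ IsDiffShannonType zyInequality ∧
    ∃ Q : MarginalModel zyScenario (fun _ => Fin 1 → ℝ),
      (∀ S, HasFiniteDiffEntropy (Q.dist S)) ∧
      (∀ S, diffEntropy (Q.dist S) = fZY S) ∧
      evalOn zyInequality (fun S => diffEntropy (Q.dist S)) < 0 ∧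
      Q.IsContextual ∧
      (∃ g : Finset Var → ℝ, IsSubmodular g ∧
        ∀ S : zyScenario.faces, g S.1 = diffEntropy (Q.dist S)) ∧
      (∀ c : Finset Var → ℝ, IsDiffShannonType c → SupportedOn zyScenario c →
        0 ≤ evalOn c (fun S => diffEntropy (Q.dist S))) := by
  have hH : (fun S => shannonEntropy (zyModel.dist S)) = fZY := funext shannonEntropy_zyModel
  have hh : (fun S => diffEntropy (contModel.dist S)) = fZY := funext diffEntropy_contModel
  have hf : fZY = fun S : zyScenario.faces => (rankZY S.1 : ℝ) := funext fZY_eq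
  have hneg : evalOn zyInequality fZY < 0 := by rw [evalOn_fZY]; norm_num
  refine ⟨isPartialPolymatroid_fZY, shannonEntropy_zyModel, supportedOn_zyInequality,
    isEntropicInequality_zyInequality, not_isShannonType_zyInequality, ?_, zyModel_isContextual,
    ⟨_, isPolymatroid_rankZY, fun S => (fZY_eq S).symm⟩, fun c hc hs => ?_,
    isDiffEntropicInequality_zyInequality, not_isDiffShannonType_zyInequality, contModel,
    fun S => hasFiniteDiffEntropy_contDist S.1, diffEntropy_contModel, ?_, contModel_isContextual,
    ⟨_, isSubmodular_rankZY, fun S => ?_⟩, fun c hc hs => ?_⟩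
  · rwa [hH]
  · rw [hH, hf, evalOn_eq_sum hs fun S => (rankZY S : ℝ)]
    exact hc.sum_nonneg isPolymatroid_rankZY
  · rwa [hh]
  · rw [diffEntropy_contModel, fZY_eq]
  · rw [hh, hf, evalOn_eq_sum hs fun S => (rankZY S : ℝ)]
    exact hc.sum_nonneg isSubmodular_rankZY
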